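/- **Setup.** For each number of sectors $S\in\mathbb N$ let $N=N_S$ be the number of regions, and let the random variables $Y_i(0),\ \beta_{is},\ w_{is},\ U_i\in\mathbb R^p,\ \mathcal Z_s\in\mathbb R^p,\ \mathcal X_s$ and the random functions $L_i(x_1,\dots,x_S)$ ($i=1,\dots,N$, $s=1,\dots,S$) be defined on a probability space that may depend on $S$ (a triangular array; the index $S$ is suppressed, $p$ is fixed). Shares satisfy $w_{is}\ge 0$ and $\sum_s w_{is}\le 1$ almost surely; they may be random. Potential outcomes are $$Y_i(x_1,\dots,x_S)=Y_i(0)+\sum_{s}w_{is}x_s\beta_{is}+L_i(x_1,\dots,x_S).$$ One observes $Y_i=Y_i(\mathcal X_1,\dots,\mathcal X_S)$, the shift-share regressor $X_i=\sum_s w_{is}\mathcal X_s$ and the controls $Z_i=\sum_s w_{is}\mathcal Z_s+U_i$. Put $L_i=L_i(\mathcal X_1,\dots,\mathcal X_S)$, $n_s=\sum_i w_{is}$, $\mathcal F_0=\sigma(\mathcal Z,U,Y(0),B,W)$ with $B=(\beta_{is})$, $W=(w_{is})$, and $\sigma_s^2=\operatorname{var}(\mathcal X_s\mid\mathcal F_0)$.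 Let $\ddot X=X-Z(Z'Z)^{-1}Z'X$ and let $\hat\beta=\ddot X'Y/\ddot X'\ddot X$ be the OLS coefficient on $X_i$ in the regression of $Y_i$ on $(X_i,Z_i)$. **Assumptions** (limits as $S\to\infty$; all bounds are constants that do not depend on $S$, $i$, $s$). 1. There is a fixed $\gamma\in\mathbb R^p$ with $E[\mathcal X_s\mid\mathcal F_0]=\mathcal Z_s'\gamma$ for every $s$. 2. Conditionally on $\mathcal F_0$, the shifters $\mathcal X_1,\dots,\mathcal X_S$ are independent. 3. $\max_s n_s/N\to 0$ in probability. 4. $N^{-1}\sum_i E[(U_i'\gamma)^2]\to 0$. 5. $|\beta_{is}|$ is almost surely bounded by a constant. 6. $N^{-1}\sum_i\sum_s w_{is}^2\sigma_s^2$ converges in probability to a non-random strictly positive limit. 7. For some $\nu>0$, $E[|\mathcal X_s|^{2+\nu}\mid\mathcal F_0]$ exists and is uniformly bounded; $E[Y_i(0)^2\mid W]$, and $E[U_{ik}^2\mid W]$, $E[\mathcal Z_{sk}^2\mid W]$ for every component $k$, exist and are uniformly bounded. 8. $E[L_i^2]<\infty$ for all $i$, and $N^{-1}\sum_i E[L_i^2]^{1/2}\to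 0$. 9. $Z'Z/N$ converges in probability to a non-random positive definite matrix. **Proposition 3.** With probability approaching one, $Z'Z$ is invertible, $\ddot X'\ddot X>0$ and $\sum_{i,s}w_{is}^2\sigma_s^2>0$, so that $\hat\beta$ and $$\bar\beta=\frac{\sum_{i}\sum_{s}w_{is}^2\sigma_s^2\beta_{is}}{\sum_{i}\sum_{s}w_{is}^2\sigma_s^2}$$ are well defined, and $$\hat\beta-\bar\beta\to 0\quad\text{in probability as } S\to\infty .$$ If moreover the effects are homogeneous, i.e. $\beta_{is}=\beta$ almost surely for all $i,s$ with $\beta$ a constant (which may depend on $S$), then $\bar\beta=\beta$ with probability approaching one and $\hat\beta-\beta\to 0$ in probability. -/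

import Mathlib

open MeasureTheory ProbabilityTheory Filter Topology Matrix

/-- Convergence in probability to a constant, for a triangular array: the `S`-th variable may live
on its own probability space. -/
def ConvInProb {Ω : ℕ → Type*} [∀ S, MeasurableSpace (Ω S)] (P : ∀ S, Measure (Ω S))
    (A : ∀ S, Ω S → ℝ) (a : ℝ) : Prop :=
  ∀ ε : ℝ, 0 < ε → Tendsto (fun S => P S {ω | ε ≤ |A S ω - a|}) atTop (𝓝 0)

/-- The real random variables `X s` are mutually independent conditionally on `m`. On a standard
Borel space this is `ProbabilityTheory.iCondIndepFun`; no such restriction is needed here. -/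
def CondIndepGiven {Ω ι : Type*} (m : MeasurableSpace Ω) [MeasurableSpace Ω] (P : Measure Ω)
    (X : ι → Ω → ℝ) : Prop :=
  ∀ (T : Finset ι) (A : ι → Set ℝ), (∀ s ∈ T, MeasurableSet (A s)) →
    P⟦⋂ s ∈ T, X s ⁻¹' A s | m⟧ =ᵐ[P] ∏ s ∈ T, P⟦X s ⁻¹' A s | m⟧

/-- `E[f | m]` exists and is bounded by `C` almost surely, for a nonnegative `f`. -/
def CondMeanLE {Ω : Type*} (m : MeasurableSpace Ω) [MeasurableSpace Ω] (P : Measure Ω)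
    (f : Ω → ℝ) (C : ℝ) : Prop :=
  Integrable f P ∧ ∀ᵐ ω ∂P, (P[f | m]) ω ≤ C

/-- The random variables that generate one row of the triangular array, with `S` sectors, `N`
regions and `p` controls. -/
structure ShiftShare (S N p : ℕ) (Ω : Type*) [MeasurableSpace Ω] where
  /-- potential outcome `Y_i(0)` in the absence of shocks -/
  Y0 : Fin N → Ω → ℝ
  /-- treatment effects `β_is` -/
  B : Fin N → Fin S → Ω → ℝ
  /-- shares `w_is` -/
  w : Fin N → Fin S → Ω → ℝ
  /-- measurement errors `U_ik` in the controls -/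
  U : Fin N → Fin p → Ω → ℝ
  /-- sector-level controls (the calligraphic `Z_sk`) -/
  ZZ : Fin S → Fin p → Ω → ℝ
  /-- sector-level shifters (the calligraphic `X_s`) -/
  XX : Fin S → Ω → ℝ
  /-- linearization error `L_i(x_1, …, x_S)` of the potential outcomes -/
  Lfun : Fin N → (Fin S → ℝ) → Ω → ℝ
  measurable_Y0 : ∀ i, Measurable (Y0 i)
  measurable_B : ∀ i s, Measurable (B i s)
  measurable_w : ∀ i s, Measurable (w i s)
  measurable_U : ∀ i k, Measurable (U i k)
  measurable_ZZ : ∀ s k, Measurable (ZZ s k)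
  measurable_XX : ∀ s, Measurable (XX s)
  measurable_Lfun : ∀ i, Measurable fun ω => Lfun i (fun s => XX s ω) ω

namespace ShiftShare

variable {S N p : ℕ} {Ω : Type*} [MeasurableSpace Ω]

/-- `Y_i(x_1, …, x_S) = Y_i(0) + ∑_s w_is x_s β_is + L_i(x_1, …, x_S)`. -/
def potentialOutcome (D : ShiftShare S N p Ω) (i : Fin N) (x : Fin S → ℝ) (ω : Ω) : ℝ :=
  D.Y0 i ω + ∑ s, D.w i s ω * x s * D.B i s ω + D.Lfun i x ω

/-- Realized linearization error `L_i`. -/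
def L (D : ShiftShare S N p Ω) (i : Fin N) (ω : Ω) : ℝ :=
  D.Lfun i (fun s => D.XX s ω) ω

/-- Observed outcomes. -/
def Y (D : ShiftShare S N p Ω) (ω : Ω) : Fin N → ℝ :=
  fun i => D.potentialOutcome i (fun s => D.XX s ω) ω

/-- Shift-share regressor `X_i = ∑_s w_is X_s`. -/
def X (D : ShiftShare S N p Ω) (ω : Ω) : Fin N → ℝ :=
  fun i => ∑ s, D.w i s ω * D.XX s ω

/-- Observed controls `Z_i = ∑_s w_is Z_s + U_i`, as an `N × p` matrix. -/
def Z (D : ShiftShare S N p Ω) (ω : Ω) : Matrix (Fin N) (Fin p) ℝ :=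
  Matrix.of fun i k => ∑ s, D.w i s ω * D.ZZ s k ω + D.U i k ω

/-- Sector size `n_s = ∑_i w_is`. -/
def n (D : ShiftShare S N p Ω) (s : Fin S) (ω : Ω) : ℝ :=
  ∑ i, D.w i s ω

/-- The sigma-field generated by the shares `W`. -/
def sigmaW (D : ShiftShare S N p Ω) : MeasurableSpace Ω :=
  ⨆ i, ⨆ s, MeasurableSpace.comap (D.w i s) inferInstance

/-- The sigma-field `F_0` generated by the sector-level controls, `U`, `Y(0)`, `B` and `W`. -/
def F0 (D : ShiftShare S N p Ω) : MeasurableSpace Ω :=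
  (⨆ s, ⨆ k, MeasurableSpace.comap (D.ZZ s k) inferInstance) ⊔
  (⨆ i, ⨆ k, MeasurableSpace.comap (D.U i k) inferInstance) ⊔
  (⨆ i, MeasurableSpace.comap (D.Y0 i) inferInstance) ⊔
  (⨆ i, ⨆ s, MeasurableSpace.comap (D.B i s) inferInstance) ⊔
  D.sigmaW

/-- `σ_s² = Var(X_s | F_0)`. -/
noncomputable def condVariance (D : ShiftShare S N p Ω) (P : Measure Ω) (s : Fin S) : Ω → ℝ :=
  Var[D.XX s; P | D.F0]

/-- Residuals `X - Z (Z'Z)⁻¹ Z'X` of the regression of the shift-share regressor on the controls. -/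
noncomputable def Xres (D : ShiftShare S N p Ω) (ω : Ω) : Fin N → ℝ :=
  D.X ω - D.Z ω *ᵥ (((D.Z ω)ᵀ * D.Z ω)⁻¹ *ᵥ ((D.Z ω)ᵀ *ᵥ D.X ω))

/-- OLS coefficient on the shift-share regressor in the regression of `Y` on `(X, Z)`. -/
noncomputable def betaHat (D : ShiftShare S N p Ω) (ω : Ω) : ℝ :=
  (D.Xres ω ⬝ᵥ D.Y ω) / (D.Xres ω ⬝ᵥ D.Xres ω)

/-- `∑_i ∑_s w_is² σ_s²`. -/
noncomputable def totalWeight (D : ShiftShare S N p Ω) (P : Measure Ω) (ω : Ω) : ℝ :=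
  ∑ i, ∑ s, D.w i s ω ^ 2 * D.condVariance P s ω

/-- The estimand `∑ w_is² σ_s² β_is / ∑ w_is² σ_s²`. -/
noncomputable def betaBar (D : ShiftShare S N p Ω) (P : Measure Ω) (ω : Ω) : ℝ :=
  (∑ i, ∑ s, D.w i s ω ^ 2 * D.condVariance P s ω * D.B i s ω) / D.totalWeight P ω

end ShiftShare

/-! The regressor splits as `X = A - E + Zγ`. Here `A_i` is the share-weighted sum of the shifters
minus their conditional means (`exposure`), and `E_i = U_i'γ` (`controlError`). When `Z'Z` is
invertible, partialling out `Z` kills `Zγ`, so `X` may be replaced by `v = A - E`. The OLS numerator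
over `N` is then `v'Y/N - (Z'v/N)'(Z'Z/N)⁻¹(Z'Y/N)`, and the denominator has the same form with `v`
in place of `Y`.

The term `E` is negligible by Cauchy-Schwarz, because its mean square vanishes. The error `L` is
negligible because its average L² norm vanishes. What remains concerns `A`, and it is settled by
concentration conditional on `F0`, where the shifters are independent with known mean.

Linear averages: for `F0`-measurable `g`, the average of `A_i g_i` is a linear form in the centred
shifters. Its conditional variance is at most a constant times `(max n_s / N)` times the average of
`g_i²`, so it vanishes. This handles `Z'A` and `A'Y(0)`.

Quadratic averages: `A` against `∑_s w_is (X_s - E[X_s | F0]) b_is` is a quadratic form with matrix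
`M_ts = ∑_i w_it w_is b_is / N`. The sum of its squared entries is again at most a constant times
`max n_s / N`. Off-diagonal products are orthogonal, so Chebyshev applies to them. On the diagonal
fourth moments may fail to exist, so the squares are truncated at a level `R`; the remainder is
controlled in L¹ by the `2 + ν` moment. The form therefore concentrates at `∑ w_is² σ_s² b_is / N`.
Taking `b = 1` gives the limit of the denominator, and `b = β` gives the numerator of `betaBar`.

It follows that `Z'v/N` vanishes while the other factors of the projection terms are tight, so these
terms drop out. The ratio converges because the limit of the denominator is positive. -/

/-! ### Concentration of linear and quadratic forms in independent variables -/

section Independent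

variable {Ω ι : Type*} [MeasurableSpace Ω] {μ : Measure Ω}

/-- Chebyshev's inequality for a sum of orthogonal random variables. -/
theorem measure_abs_sum_ge_le_of_orthogonal [IsFiniteMeasure μ] (T : Finset ι) {Y : ι → Ω → ℝ}
    (hY : ∀ a ∈ T, MemLp (Y a) 2 μ)
    (horth : ∀ a ∈ T, ∀ b ∈ T, a ≠ b → ∫ ω, Y a ω * Y b ω ∂μ = 0) {ε : ℝ} (hε : 0 < ε) :
    μ {ω | ε ≤ |∑ a ∈ T, Y a ω|} ≤ ENNReal.ofReal ((∑ a ∈ T, ∫ ω, Y a ω ^ 2 ∂μ) / ε ^ 2) := by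
  have h_int : ∀ a ∈ T, ∀ b ∈ T, Integrable (fun ω => Y a ω * Y b ω) μ := fun a ha b hb =>
    (hY a ha).integrable_mul (hY b hb)
  have hsq : ∀ ω, (∑ a ∈ T, Y a ω) ^ 2 = ∑ a ∈ T, ∑ b ∈ T, Y a ω * Y b ω := fun ω => by
    rw [sq, Finset.sum_mul_sum]
  have hsum : ∫ ω, (∑ a ∈ T, Y a ω) ^ 2 ∂μ = ∑ a ∈ T, ∫ ω, Y a ω ^ 2 ∂μ := by
    simp_rw [hsq]
    rw [integral_finsetSum _ fun a ha => integrable_finsetSum _ fun b hb => h_int a ha b hb]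
    refine Finset.sum_congr rfl fun a ha => ?_
    rw [integral_finsetSum _ fun b hb => h_int a ha b hb, Finset.sum_eq_single a]
    · simp_rw [sq]
    · intro b hb hba
      exact horth a ha b hb hba.symm
    · exact fun h => absurd ha h
  have hi : Integrable (fun ω => (∑ a ∈ T, Y a ω) ^ 2) μ := by
    simp_rw [hsq]
    exact integrable_finsetSum _ fun a ha => integrable_finsetSum _ fun b hb => h_int a ha b hb
  have hset : {ω | ε ≤ |∑ a ∈ T, Y a ω|} ⊆ {ω | ε ^ 2 ≤ (∑ a ∈ T, Y a ω) ^ 2} := by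
    intro ω hω
    simp only [Set.mem_ofPred_eq] at hω ⊢
    rw [← sq_abs (∑ a ∈ T, Y a ω)]
    gcongr
  have hM := mul_meas_ge_le_integral_of_nonneg (μ := μ)
    (f := fun ω => (∑ a ∈ T, Y a ω) ^ 2) (Eventually.of_forall fun ω => sq_nonneg _) hi (ε ^ 2)
  rw [hsum] at hM
  refine (measure_mono hset).trans ?_
  rw [← ENNReal.ofReal_toReal (measure_ne_top μ {ω | ε ^ 2 ≤ (∑ a ∈ T, Y a ω) ^ 2})]
  apply ENNReal.ofReal_le_ofReal
  rw [le_div_iff₀ (by positivity), mul_comm]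
  exact hM

/-- Markov's inequality for the mean absolute value. -/
theorem measure_abs_ge_le_of_integral_abs [IsFiniteMeasure μ] {f : Ω → ℝ} (hf : Integrable f μ)
    {ε : ℝ} (hε : 0 < ε) :
    μ {ω | ε ≤ |f ω|} ≤ ENNReal.ofReal ((∫ ω, |f ω| ∂μ) / ε) := by
  have hM := mul_meas_ge_le_integral_of_nonneg (μ := μ)
    (f := fun ω => |f ω|) (Eventually.of_forall fun ω => abs_nonneg _) hf.abs ε
  rw [← ENNReal.ofReal_toReal (measure_ne_top μ {ω | ε ≤ |f ω|})]
  apply ENNReal.ofReal_le_ofReal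
  rw [le_div_iff₀ (by positivity), mul_comm]
  exact hM

variable {ξ : ι → Ω → ℝ} {C : ℝ}

/-- Two distinct increasing pairs cannot have the same underlying set, so some index occurs exactly
once among the four. By independence the integral factorizes over indices, and that index
contributes a zero mean. -/
theorem integral_mul_mul_mul_eq_zero [Fintype ι] [LinearOrder ι] (hind : iIndepFun ξ μ)
    (hL2 : ∀ s, MemLp (ξ s) 2 μ) (hmean : ∀ s, ∫ ω, ξ s ω ∂μ = 0) {s t s' t' : ι}
    (hst : s < t) (hst' : s' < t') (hne : (s, t) ≠ (s', t')) :
    ∫ ω, ξ s ω * ξ t ω * (ξ s' ω * ξ t' ω) ∂μ = 0 := by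
  -- `e r` is the multiplicity of `r` among `s, t, s', t'`.
  let e : ι → ℕ := fun r => (if s = r then 1 else 0) + (if t = r then 1 else 0) +
    ((if s' = r then 1 else 0) + (if t' = r then 1 else 0))
  have hprod : ∀ ω, ξ s ω * ξ t ω * (ξ s' ω * ξ t' ω) = ∏ r, ξ r ω ^ e r := by
    intro ω
    simp only [e, pow_add, Finset.prod_mul_distrib, Finset.prod_pow_boole, Finset.mem_univ,
      if_true]
  simp_rw [hprod]
  rw [hind.integral_fun_prod_comp (f := fun r x => x ^ e r)
    (fun r => (hL2 r).1.aemeasurable) (fun r => by fun_prop)]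
  have hex : ∃ r, e r = 1 := by
    by_cases h1 : s' = s ∨ t' = s
    · by_cases h2 : s' = t ∨ t' = t
      · exfalso
        rcases h1 with rfl | rfl <;> rcases h2 with rfl | rfl
        · exact lt_irrefl _ hst
        · exact hne rfl
        · exact lt_asymm hst hst'
        · exact lt_irrefl _ hst
      · push Not at h2
        exact ⟨t, by simp [e, hst.ne, h2.1, h2.2]⟩
    · push Not at h1
      exact ⟨s, by simp [e, hst.ne', h1.1, h1.2]⟩
  obtain ⟨r, hr⟩ := hex
  refine Finset.prod_eq_zero (Finset.mem_univ r) ?_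
  simpa [hr] using hmean r

variable [IsProbabilityMeasure μ]

theorem measure_abs_linear_ge_le [Fintype ι] (hind : iIndepFun ξ μ)
    (hL2 : ∀ s, MemLp (ξ s) 2 μ) (hmean : ∀ s, ∫ ω, ξ s ω ∂μ = 0)
    (hC : ∀ s, ∫ ω, ξ s ω ^ 2 ∂μ ≤ C) (c : ι → ℝ) {ε : ℝ} (hε : 0 < ε) :
    μ {ω | ε ≤ |∑ s, c s * ξ s ω|} ≤ ENNReal.ofReal (C * (∑ s, c s ^ 2) / ε ^ 2) := by
  refine (measure_abs_sum_ge_le_of_orthogonal Finset.univ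
    (fun s _ => (hL2 s).const_mul (c s)) ?_ hε).trans ?_
  · intro s _ t _ hst
    have := (hind.indepFun hst).integral_fun_mul_eq_mul_integral (hL2 s).1 (hL2 t).1
    have h2 : ∀ ω, c s * ξ s ω * (c t * ξ t ω) = (c s * c t) * (ξ s ω * ξ t ω) := fun ω => by ring
    simp_rw [h2]
    rw [integral_const_mul, this, hmean s]
    ring
  · apply ENNReal.ofReal_le_ofReal
    gcongr
    rw [Finset.mul_sum]
    refine Finset.sum_le_sum fun s _ => ?_
    simp_rw [mul_pow]
    rw [integral_const_mul, mul_comm C]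
    exact mul_le_mul_of_nonneg_left (hC s) (sq_nonneg _)

/-- Products of two distinct variables are square integrable with only second moments assumed,
because the squares of independent variables are independent. Restricting to `s < t` makes the
products pairwise orthogonal, as symmetric duplicates are excluded. -/
theorem measure_abs_strictUpper_ge_le [Fintype ι] [LinearOrder ι] (hind : iIndepFun ξ μ)
    (hL2 : ∀ s, MemLp (ξ s) 2 μ) (hmean : ∀ s, ∫ ω, ξ s ω ∂μ = 0)
    (hC : ∀ s, ∫ ω, ξ s ω ^ 2 ∂μ ≤ C) (M : ι → ι → ℝ) {ε : ℝ} (hε : 0 < ε) :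
    μ {ω | ε ≤ |∑ x : ι × ι with x.1 < x.2, M x.1 x.2 * (ξ x.1 ω * ξ x.2 ω)|} ≤
      ENNReal.ofReal (C ^ 2 * (∑ s, ∑ t, M s t ^ 2) / ε ^ 2) := by
  have hsqint : ∀ s, Integrable (fun ω => ξ s ω ^ 2) μ := fun s => (hL2 s).integrable_sq
  have hindsq : ∀ x : ι × ι, x.1 < x.2 →
      IndepFun (fun ω => ξ x.1 ω ^ 2) (fun ω => ξ x.2 ω ^ 2) μ := fun x hx =>
    (hind.indepFun hx.ne).comp (φ := fun y : ℝ => y ^ 2) (ψ := fun y : ℝ => y ^ 2)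
      (by fun_prop) (by fun_prop)
  have hmem : ∀ x : ι × ι, x.1 < x.2 → MemLp (fun ω => ξ x.1 ω * ξ x.2 ω) 2 μ := by
    intro x hx
    refine (memLp_two_iff_integrable_sq ((hL2 x.1).1.mul (hL2 x.2).1)).2 ?_
    have := (hindsq x hx).integrable_mul (hsqint x.1) (hsqint x.2)
    refine this.congr (Eventually.of_forall fun ω => ?_)
    simp [mul_pow]
  refine (measure_abs_sum_ge_le_of_orthogonal (Finset.univ.filter fun x : ι × ι => x.1 < x.2)
    (Y := fun x ω => M x.1 x.2 * (ξ x.1 ω * ξ x.2 ω))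
    (fun x hx => (hmem x (Finset.mem_filter.1 hx).2).const_mul _) ?_ hε).trans ?_
  · intro x hx y hy hxy
    have h2 : ∀ ω, M x.1 x.2 * (ξ x.1 ω * ξ x.2 ω) * (M y.1 y.2 * (ξ y.1 ω * ξ y.2 ω)) =
        (M x.1 x.2 * M y.1 y.2) * (ξ x.1 ω * ξ x.2 ω * (ξ y.1 ω * ξ y.2 ω)) := fun ω => by ring
    simp_rw [h2]
    rw [integral_const_mul, integral_mul_mul_mul_eq_zero hind hL2 hmean
      (Finset.mem_filter.1 hx).2 (Finset.mem_filter.1 hy).2 hxy, mul_zero]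
  · apply ENNReal.ofReal_le_ofReal
    gcongr
    have hle : ∀ x ∈ Finset.univ.filter (fun x : ι × ι => x.1 < x.2),
        ∫ ω, (M x.1 x.2 * (ξ x.1 ω * ξ x.2 ω)) ^ 2 ∂μ ≤ C ^ 2 * M x.1 x.2 ^ 2 := by
      intro x hx
      simp_rw [mul_pow]
      rw [integral_const_mul, (hindsq x (Finset.mem_filter.1 hx).2).integral_fun_mul_eq_mul_integral
        (hsqint x.1).1 (hsqint x.2).1, mul_comm]
      gcongr
      rw [sq C]
      exact mul_le_mul (hC _) (hC _) (integral_nonneg fun _ => sq_nonneg _)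
        ((integral_nonneg fun _ => sq_nonneg _).trans (hC x.1))
    refine (Finset.sum_le_sum hle).trans ?_
    rw [← Finset.mul_sum]
    gcongr
    rw [← Finset.univ_product_univ, ← Finset.sum_product (f := fun x : ι × ι => M x.1 x.2 ^ 2)]
    exact Finset.sum_le_sum_of_subset_of_nonneg (Finset.filter_subset _ _)
      fun _ _ _ => sq_nonneg _

/-- The square, cut off to zero outside `[-R, R]`. -/
noncomputable def truncSq (R x : ℝ) : ℝ := if |x| ≤ R then x ^ 2 else 0

theorem measurable_truncSq (R : ℝ) : Measurable (truncSq R) :=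
  Measurable.ite (measurableSet_le (by fun_prop) (by fun_prop)) (by fun_prop) (by fun_prop)

theorem truncSq_nonneg (R x : ℝ) : 0 ≤ truncSq R x := by
  unfold truncSq; split_ifs <;> positivity

theorem truncSq_le_sq (R x : ℝ) : truncSq R x ≤ x ^ 2 := by
  unfold truncSq; split_ifs; exacts [le_rfl, sq_nonneg _]

theorem truncSq_le (R x : ℝ) : truncSq R x ≤ R ^ 2 := by
  unfold truncSq; split_ifs with h
  · rw [← sq_abs]; gcongr
  · positivity

theorem sq_sub_truncSq_le {R ν : ℝ} (hR : 0 < R) (hν : 0 ≤ ν) (x : ℝ) :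
    x ^ 2 - truncSq R x ≤ |x| ^ (2 + ν) / R ^ ν := by
  unfold truncSq; split_ifs with h
  · rw [sub_self]; positivity
  · push Not at h
    have hx : 0 < |x| := hR.trans h
    rw [sub_zero, le_div_iff₀ (by positivity), Real.rpow_add hx, ← sq_abs]
    norm_cast
    gcongr

/-- The squares need not have a variance. The truncated squares are bounded by `R ^ 2`, so Chebyshev
applies with variance at most `R ^ 4`. The remainder is nonnegative with mean at most `τ`, so once
centred it has L¹ norm at most `2 * τ`, and Markov applies. Each piece is allotted `ε / 2`. -/
theorem measure_abs_diag_ge_le [Fintype ι] (hind : iIndepFun ξ μ)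
    (hL2 : ∀ s, MemLp (ξ s) 2 μ) {R τ : ℝ}
    (hτ : ∀ s, ∫ ω, ξ s ω ^ 2 - truncSq R (ξ s ω) ∂μ ≤ τ) (d : ι → ℝ) {ε : ℝ} (hε : 0 < ε) :
    μ {ω | ε ≤ |∑ s, d s * (ξ s ω ^ 2 - ∫ ω', ξ s ω' ^ 2 ∂μ)|} ≤
      ENNReal.ofReal (R ^ 4 * (∑ s, d s ^ 2) / (ε / 2) ^ 2) +
      ENNReal.ofReal (2 * τ * (∑ s, |d s|) / (ε / 2)) := by
  have hsqint : ∀ s, Integrable (fun ω => ξ s ω ^ 2) μ := fun s => (hL2 s).integrable_sq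
  have htm : ∀ s, AEStronglyMeasurable (fun ω => truncSq R (ξ s ω)) μ := fun s =>
    ((measurable_truncSq R).comp_aemeasurable (hL2 s).1.aemeasurable).aestronglyMeasurable
  have htb : ∀ s, ∀ᵐ ω ∂μ, ‖truncSq R (ξ s ω)‖ ≤ R ^ 2 := fun s =>
    Eventually.of_forall fun ω => by
      rw [Real.norm_of_nonneg (truncSq_nonneg _ _)]; exact truncSq_le _ _
  have htL2 : ∀ s, MemLp (fun ω => truncSq R (ξ s ω)) 2 μ := fun s =>
    MemLp.of_bound (htm s) _ (htb s)
  have htint : ∀ s, Integrable (fun ω => truncSq R (ξ s ω)) μ := fun s =>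
    (htL2 s).integrable one_le_two
  let e : ι → ℝ := fun s => ∫ ω, truncSq R (ξ s ω) ∂μ
  have hcL2 : ∀ s, MemLp (fun ω => truncSq R (ξ s ω) - e s) 2 μ := fun s =>
    (htL2 s).sub (memLp_const _)
  have hA := measure_abs_sum_ge_le_of_orthogonal (μ := μ) Finset.univ
    (Y := fun s ω => d s * (truncSq R (ξ s ω) - e s))
    (fun s _ => (hcL2 s).const_mul _) (by
      intro s _ t _ hst
      have hi : IndepFun (fun ω => truncSq R (ξ s ω) - e s) (fun ω => truncSq R (ξ t ω) - e t) μ :=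
        (hind.indepFun hst).comp (φ := fun y => truncSq R y - e s)
          (ψ := fun y => truncSq R y - e t) ((measurable_truncSq R).sub_const _)
          ((measurable_truncSq R).sub_const _)
      have h2 : ∀ ω, d s * (truncSq R (ξ s ω) - e s) * (d t * (truncSq R (ξ t ω) - e t)) =
        (d s * d t) * ((truncSq R (ξ s ω) - e s) * (truncSq R (ξ t ω) - e t)) := fun ω => by ring
      simp_rw [h2]
      rw [integral_const_mul, hi.integral_fun_mul_eq_mul_integral (hcL2 s).1 (hcL2 t).1,
        integral_sub (htint s) (integrable_const _)]
      simp [e]) (half_pos hε)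
  have hrint : ∀ s, Integrable (fun ω => ξ s ω ^ 2 - truncSq R (ξ s ω)) μ := fun s =>
    (hsqint s).sub (htint s)
  let r : ι → ℝ := fun s => ∫ ω, ξ s ω ^ 2 - truncSq R (ξ s ω) ∂μ
  have hr : ∀ s, ∫ ω, ξ s ω ^ 2 ∂μ = e s + r s := fun s => by
    simp only [e, r]
    rw [integral_sub (hsqint s) (htint s)]; ring
  have hr0 : ∀ s, 0 ≤ r s := fun s => integral_nonneg fun ω => sub_nonneg.2 (truncSq_le_sq _ _)
  have hdint : ∀ s, Integrable (fun ω => d s * (ξ s ω ^ 2 - truncSq R (ξ s ω) - r s)) μ :=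
    fun s => ((hrint s).sub (integrable_const _)).const_mul _
  have hB := measure_abs_ge_le_of_integral_abs (μ := μ)
    (f := fun ω => ∑ s, d s * (ξ s ω ^ 2 - truncSq R (ξ s ω) - r s))
    (integrable_finsetSum _ fun s _ => hdint s) (half_pos hε)
  have hsub : {ω | ε ≤ |∑ s, d s * (ξ s ω ^ 2 - ∫ ω', ξ s ω' ^ 2 ∂μ)|} ⊆
      {ω | ε / 2 ≤ |∑ s, d s * (truncSq R (ξ s ω) - e s)|} ∪
      {ω | ε / 2 ≤ |∑ s, d s * (ξ s ω ^ 2 - truncSq R (ξ s ω) - r s)|} := by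
    intro ω hω
    simp only [Set.mem_ofPred_eq, Set.mem_union] at hω ⊢
    by_contra! hcon
    have heq : ∑ s, d s * (ξ s ω ^ 2 - ∫ ω', ξ s ω' ^ 2 ∂μ) =
        ∑ s, d s * (truncSq R (ξ s ω) - e s) +
        ∑ s, d s * (ξ s ω ^ 2 - truncSq R (ξ s ω) - r s) := by
      rw [← Finset.sum_add_distrib]
      refine Finset.sum_congr rfl fun s _ => ?_
      rw [hr s]; ring
    rw [heq] at hω
    have := abs_add_le (∑ s, d s * (truncSq R (ξ s ω) - e s))
      (∑ s, d s * (ξ s ω ^ 2 - truncSq R (ξ s ω) - r s))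
    linarith [hcon.1, hcon.2]
  refine (measure_mono hsub).trans ((measure_union_le _ _).trans (add_le_add (hA.trans ?_)
    (hB.trans ?_)))
  · apply ENNReal.ofReal_le_ofReal
    gcongr
    rw [Finset.mul_sum]
    refine Finset.sum_le_sum fun s _ => ?_
    simp_rw [mul_pow]
    rw [integral_const_mul, mul_comm (R ^ 4)]
    gcongr
    have hv : ∫ ω, (truncSq R (ξ s ω) - e s) ^ 2 ∂μ ≤ ∫ ω, truncSq R (ξ s ω) ^ 2 ∂μ := by
      have := variance_le_expectation_sq (μ := μ) (htm s)
      rwa [variance_eq_integral (htm s).aemeasurable] at this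
    refine hv.trans ?_
    have : ∫ ω, truncSq R (ξ s ω) ^ 2 ∂μ ≤ ∫ _, R ^ 4 ∂μ := by
      refine integral_mono (htL2 s).integrable_sq (integrable_const _) fun ω => ?_
      have := pow_le_pow_left₀ (truncSq_nonneg R (ξ s ω)) (truncSq_le R (ξ s ω)) 2
      calc truncSq R (ξ s ω) ^ 2 ≤ (R ^ 2) ^ 2 := this
        _ = R ^ 4 := by ring
    simpa using this
  · apply ENNReal.ofReal_le_ofReal
    gcongr
    have h1 : ∫ ω, |∑ s, d s * (ξ s ω ^ 2 - truncSq R (ξ s ω) - r s)| ∂μ ≤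
        ∫ ω, ∑ s, |d s| * ((ξ s ω ^ 2 - truncSq R (ξ s ω)) + r s) ∂μ := by
      refine integral_mono (integrable_finsetSum _ fun s _ => hdint s).abs
        (integrable_finsetSum _ fun s _ => ((hrint s).add (integrable_const _)).const_mul _)
        fun ω => ?_
      refine (Finset.abs_sum_le_sum_abs _ _).trans (Finset.sum_le_sum fun s _ => ?_)
      rw [abs_mul]
      gcongr
      refine (abs_sub _ _).trans ?_
      rw [abs_of_nonneg (hr0 s), abs_of_nonneg (sub_nonneg.2 (truncSq_le_sq R (ξ s ω)))]
    refine h1.trans ?_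
    have hri : ∀ s, Integrable (fun ω => |d s| * ((ξ s ω ^ 2 - truncSq R (ξ s ω)) + r s)) μ :=
      fun s => ((hrint s).add (integrable_const _)).const_mul _
    rw [integral_finsetSum _ fun s _ => hri s, Finset.mul_sum]
    refine Finset.sum_le_sum fun s _ => ?_
    rw [integral_const_mul, integral_add (hrint s) (integrable_const _), mul_comm]
    gcongr
    simp only [integral_const, probReal_univ, one_smul]
    have : r s ≤ τ := hτ s
    linarith

/-- Concentration of a quadratic form in independent centred variables around its mean. -/
theorem measure_abs_quadratic_ge_le [Fintype ι] [LinearOrder ι] (hind : iIndepFun ξ μ)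
    (hL2 : ∀ s, MemLp (ξ s) 2 μ) (hmean : ∀ s, ∫ ω, ξ s ω ∂μ = 0)
    (hC : ∀ s, ∫ ω, ξ s ω ^ 2 ∂μ ≤ C) {R τ : ℝ}
    (hτ : ∀ s, ∫ ω, ξ s ω ^ 2 - truncSq R (ξ s ω) ∂μ ≤ τ)
    (M : ι → ι → ℝ) {ε : ℝ} (hε : 0 < ε) :
    μ {ω | ε ≤ |∑ s, ∑ t, M s t * (ξ s ω * ξ t ω) - ∑ s, M s s * ∫ ω', ξ s ω' ^ 2 ∂μ|} ≤
      ENNReal.ofReal (C ^ 2 * (∑ s, ∑ t, M s t ^ 2) / (ε / 3) ^ 2) +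
      ENNReal.ofReal (C ^ 2 * (∑ s, ∑ t, M s t ^ 2) / (ε / 3) ^ 2) +
      (ENNReal.ofReal (R ^ 4 * (∑ s, ∑ t, M s t ^ 2) / (ε / 3 / 2) ^ 2) +
      ENNReal.ofReal (2 * τ * (∑ s, |M s s|) / (ε / 3 / 2))) := by
  have h3 : 0 < ε / 3 := by positivity
  have hU := measure_abs_strictUpper_ge_le hind hL2 hmean hC M h3
  have hLo := measure_abs_strictUpper_ge_le hind hL2 hmean hC (fun s t => M t s) h3
  have hD := measure_abs_diag_ge_le hind hL2 hτ (fun s => M s s) h3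
  -- The strict lower triangle is written as a strict upper one for the transposed matrix. The three
  -- pieces get `ε / 3` each.
  have hdecomp : ∀ ω, ∑ s, ∑ t, M s t * (ξ s ω * ξ t ω) -
        ∑ s, M s s * ∫ ω', ξ s ω' ^ 2 ∂μ =
      ∑ x : ι × ι with x.1 < x.2, M x.1 x.2 * (ξ x.1 ω * ξ x.2 ω) +
      ∑ x : ι × ι with x.1 < x.2, M x.2 x.1 * (ξ x.1 ω * ξ x.2 ω) +
      ∑ s, M s s * (ξ s ω ^ 2 - ∫ ω', ξ s ω' ^ 2 ∂μ) := by
    intro ω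
    have e1 : ∑ x : ι × ι with x.1 < x.2, M x.1 x.2 * (ξ x.1 ω * ξ x.2 ω) =
        ∑ s, ∑ t, if s < t then M s t * (ξ s ω * ξ t ω) else 0 := by
      rw [Finset.sum_filter, ← Finset.univ_product_univ, Finset.sum_product]
    have e2 : ∑ x : ι × ι with x.1 < x.2, M x.2 x.1 * (ξ x.1 ω * ξ x.2 ω) =
        ∑ s, ∑ t, if t < s then M s t * (ξ s ω * ξ t ω) else 0 := by
      rw [Finset.sum_filter, ← Finset.univ_product_univ, Finset.sum_product, Finset.sum_comm]
      refine Finset.sum_congr rfl fun s _ => Finset.sum_congr rfl fun t _ => ?_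
      simp only [mul_comm (ξ t ω)]
    have e3 : ∑ s, M s s * (ξ s ω ^ 2 - ∫ ω', ξ s ω' ^ 2 ∂μ) =
        (∑ s, ∑ t, if s = t then M s t * (ξ s ω * ξ t ω) else 0) -
        ∑ s, M s s * ∫ ω', ξ s ω' ^ 2 ∂μ := by
      rw [← Finset.sum_sub_distrib]
      refine Finset.sum_congr rfl fun s _ => ?_
      rw [Finset.sum_ite_eq, if_pos (Finset.mem_univ _)]
      ring
    rw [e1, e2, e3, ← add_sub_assoc, ← Finset.sum_add_distrib, ← Finset.sum_add_distrib]
    congr 1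
    refine Finset.sum_congr rfl fun s _ => ?_
    rw [← Finset.sum_add_distrib, ← Finset.sum_add_distrib]
    refine Finset.sum_congr rfl fun t _ => ?_
    rcases lt_trichotomy s t with h | h | h
    · simp [h, h.not_gt, h.ne]
    · simp [h]
    · simp [h, h.not_gt, h.ne']
  have hsub : {ω | ε ≤ |∑ s, ∑ t, M s t * (ξ s ω * ξ t ω) -
      ∑ s, M s s * ∫ ω', ξ s ω' ^ 2 ∂μ|} ⊆
      ({ω | ε / 3 ≤ |∑ x : ι × ι with x.1 < x.2, M x.1 x.2 * (ξ x.1 ω * ξ x.2 ω)|} ∪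
      {ω | ε / 3 ≤ |∑ x : ι × ι with x.1 < x.2, M x.2 x.1 * (ξ x.1 ω * ξ x.2 ω)|}) ∪
      {ω | ε / 3 ≤ |∑ s, M s s * (ξ s ω ^ 2 - ∫ ω', ξ s ω' ^ 2 ∂μ)|} := by
    intro ω hω
    simp only [Set.mem_ofPred_eq, Set.mem_union] at hω ⊢
    rw [hdecomp] at hω
    by_contra! hcon
    have := abs_add_three
      (∑ x : ι × ι with x.1 < x.2, M x.1 x.2 * (ξ x.1 ω * ξ x.2 ω))
      (∑ x : ι × ι with x.1 < x.2, M x.2 x.1 * (ξ x.1 ω * ξ x.2 ω))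
      (∑ s, M s s * (ξ s ω ^ 2 - ∫ ω', ξ s ω' ^ 2 ∂μ))
    linarith [hcon.1.1, hcon.1.2, hcon.2]
  refine (measure_mono hsub).trans ((measure_union_le _ _).trans (add_le_add
    ((measure_union_le _ _).trans (add_le_add hU (hLo.trans ?_))) (hD.trans ?_)))
  · rw [Finset.sum_comm]
  · gcongr with s
    exact Finset.single_le_sum (f := fun t => M s t ^ 2) (fun _ _ => sq_nonneg _)
      (Finset.mem_univ s)

end Independent

/-! ### Moment bounds for centred variables -/

section CentredFamily

variable {Ω ι : Type*} [MeasurableSpace Ω]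

/-- An independent, centred family with variances bounded by `K` and squares that are uniformly
integrable at rate `K / R ^ ν`. -/
structure IndepCentred (μ : Measure Ω) (ξ : ι → Ω → ℝ) (K ν : ℝ) : Prop where
  indep : iIndepFun ξ μ
  memLp : ∀ s, MemLp (ξ s) 2 μ
  mean : ∀ s, ∫ ω, ξ s ω ∂μ = 0
  second : ∀ s, ∫ ω, ξ s ω ^ 2 ∂μ ≤ K
  tail : ∀ s, ∀ R : ℝ, 0 < R → ∫ ω, ξ s ω ^ 2 - truncSq R (ξ s ω) ∂μ ≤ K / R ^ ν

theorem sq_le_one_add_abs_rpow {ν : ℝ} (hν : 0 ≤ ν) (x : ℝ) : x ^ 2 ≤ 1 + |x| ^ (2 + ν) := by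
  rw [← sq_abs]
  have h0 := abs_nonneg x
  rcases le_total |x| 1 with h | h
  · have : |x| ^ 2 ≤ 1 := pow_le_one₀ h0 h
    have : 0 ≤ |x| ^ (2 + ν) := by positivity
    linarith
  · have : |x| ^ (2 : ℝ) ≤ |x| ^ (2 + ν) := Real.rpow_le_rpow_of_exponent_le h (by linarith)
    rw [Real.rpow_two] at this
    linarith

theorem abs_sub_rpow_le {q : ℝ} (hq : 0 ≤ q) (x y : ℝ) :
    |x - y| ^ q ≤ 2 ^ q * (|x| ^ q + |y| ^ q) := by
  have hx := abs_nonneg x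
  have hy := abs_nonneg y
  have h1 : |x - y| ≤ 2 * max |x| |y| := by
    refine (abs_sub x y).trans ?_
    linarith [le_max_left |x| |y|, le_max_right |x| |y|]
  have hm : 0 ≤ max |x| |y| := hx.trans (le_max_left _ _)
  calc |x - y| ^ q ≤ (2 * max |x| |y|) ^ q := Real.rpow_le_rpow (abs_nonneg _) h1 hq
    _ = 2 ^ q * (max |x| |y|) ^ q := Real.mul_rpow (by norm_num) hm
    _ ≤ 2 ^ q * (|x| ^ q + |y| ^ q) := by
      gcongr
      rcases max_choice |x| |y| with h | h <;> rw [h]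
      · linarith [Real.rpow_nonneg hy q]
      · linarith [Real.rpow_nonneg hx q]

/-- The bound on the centred moments implied by a bound `C` on the raw ones. -/
noncomputable def centredBound (ν C : ℝ) : ℝ :=
  1 + 2 ^ (2 + ν) * (C + (1 + C) ^ (2 + ν))

theorem integrable_sq_of_integrable_rpow {μ : Measure Ω} [IsFiniteMeasure μ] {f : Ω → ℝ}
    (hf : AEStronglyMeasurable f μ) {ν : ℝ} (hν : 0 ≤ ν)
    (h_int : Integrable (fun ω => |f ω| ^ (2 + ν)) μ) : MemLp f 2 μ := by
  rw [memLp_two_iff_integrable_sq hf]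
  refine ((integrable_const (1 : ℝ)).add h_int).mono' (hf.pow 2)
    (Eventually.of_forall fun ω => ?_)
  rw [Real.norm_of_nonneg (sq_nonneg _)]
  exact sq_le_one_add_abs_rpow hν _

/-- The constant `centredBound` arises as follows: `|a s| ≤ 1 + C` because `|x| ≤ 1 + |x| ^ (2 +
ν)`; the factor `2 ^ (2 + ν)` is the price of splitting `|x - a| ^ (2 + ν)`; the leading `1` comes
from `y ^ 2 ≤ 1 + |y| ^ (2 + ν)`. -/
theorem IndepCentred.of_moments {μ : Measure Ω} [IsProbabilityMeasure μ] {x : ι → Ω → ℝ}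
    {ν C : ℝ} (hν : 0 ≤ ν) {a : ι → ℝ} (hind : iIndepFun x μ)
    (hx : ∀ s, AEStronglyMeasurable (x s) μ)
    (h_int : ∀ s, Integrable (fun ω => |x s ω| ^ (2 + ν)) μ)
    (hC : ∀ s, ∫ ω, |x s ω| ^ (2 + ν) ∂μ ≤ C) (hmean : ∀ s, ∫ ω, x s ω ∂μ = a s) :
    IndepCentred μ (fun s ω => x s ω - a s) (centredBound ν C) ν := by
  have hq : 0 ≤ 2 + ν := by linarith
  have hL2 : ∀ s, MemLp (x s) 2 μ := fun s => integrable_sq_of_integrable_rpow (hx s) hν (h_int s)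
  have hL2' : ∀ s, MemLp (fun ω => x s ω - a s) 2 μ := fun s => (hL2 s).sub (memLp_const _)
  have hxint : ∀ s, Integrable (x s) μ := fun s => (hL2 s).integrable one_le_two
  have hC0 : ∀ _ : ι, 0 ≤ C := fun s => (integral_nonneg fun ω => by positivity).trans (hC s)
  have ha : ∀ s, |a s| ≤ 1 + C := by
    intro s
    rw [← hmean s]
    refine (abs_integral_le_integral_abs).trans ?_
    have : ∫ ω, |x s ω| ∂μ ≤ ∫ ω, 1 + |x s ω| ^ (2 + ν) ∂μ := by
      refine integral_mono (hxint s).abs ((integrable_const _).add (h_int s)) fun ω => ?_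
      simp only
      rcases le_total |x s ω| 1 with h | h
      · have : 0 ≤ |x s ω| ^ (2 + ν) := by positivity
        linarith
      · have := Real.rpow_le_rpow_of_exponent_le h (show (1 : ℝ) ≤ 2 + ν by linarith)
        rw [Real.rpow_one] at this
        linarith
    refine this.trans ?_
    rw [integral_add (integrable_const _) (h_int s)]
    simpa using hC s
  have hbint : ∀ s, Integrable (fun ω => 2 ^ (2 + ν) * (|x s ω| ^ (2 + ν) + (1 + C) ^ (2 + ν))) μ :=
    fun s => ((h_int s).add (integrable_const _)).const_mul _
  have hpt : ∀ s ω, |x s ω - a s| ^ (2 + ν) ≤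
      2 ^ (2 + ν) * (|x s ω| ^ (2 + ν) + (1 + C) ^ (2 + ν)) := by
    intro s ω
    refine (abs_sub_rpow_le hq _ _).trans ?_
    gcongr
    exact ha s
  have h_int' : ∀ s, Integrable (fun ω => |x s ω - a s| ^ (2 + ν)) μ := by
    intro s
    refine (hbint s).mono' ?_ (Eventually.of_forall fun ω => ?_)
    · exact ((Real.continuous_rpow_const hq).measurable.comp_aemeasurable
        (((hx s).aemeasurable.sub_const _).abs)).aestronglyMeasurable
    · rw [Real.norm_of_nonneg (by positivity)]
      exact hpt s ω
  have hmom : ∀ s, ∫ ω, |x s ω - a s| ^ (2 + ν) ∂μ ≤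
      2 ^ (2 + ν) * (C + (1 + C) ^ (2 + ν)) := by
    intro s
    refine (integral_mono (h_int' s) (hbint s) (hpt s)).trans ?_
    rw [integral_const_mul, integral_add (h_int s) (integrable_const _)]
    gcongr
    · exact hC s
    · simp
  refine ⟨?_, hL2', ?_, ?_, ?_⟩
  · exact hind.comp (fun s y => y - a s) fun s => measurable_id.sub_const _
  · intro s
    rw [integral_sub (hxint s) (integrable_const _), hmean s]
    simp
  · intro s
    have : ∫ ω, (x s ω - a s) ^ 2 ∂μ ≤ ∫ ω, 1 + |x s ω - a s| ^ (2 + ν) ∂μ :=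
      integral_mono (hL2' s).integrable_sq ((integrable_const _).add (h_int' s))
        fun ω => sq_le_one_add_abs_rpow hν _
    refine this.trans ?_
    rw [integral_add (integrable_const _) (h_int' s)]
    simpa [centredBound] using hmom s
  · intro s R hR
    have htint : Integrable (fun ω => truncSq R (x s ω - a s)) μ := by
      refine (hL2' s).integrable_sq.mono' ((measurable_truncSq R).comp_aemeasurable
        (hL2' s).1.aemeasurable).aestronglyMeasurable (Eventually.of_forall fun ω => ?_)
      rw [Real.norm_of_nonneg (truncSq_nonneg _ _)]
      exact truncSq_le_sq _ _
    refine (integral_mono ((hL2' s).integrable_sq.sub htint) ((h_int' s).div_const _)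
      fun ω => sq_sub_truncSq_le hR hν (x s ω - a s)).trans ?_
    rw [integral_div]
    gcongr
    refine (hmom s).trans ?_
    simp [centredBound]

end CentredFamily

/-! ### From conditional independence to the regular conditional law of the shifters -/

section ConditionalLaw

variable {Ω β ι : Type*} [mΩ : MeasurableSpace Ω] [mβ : MeasurableSpace β] [Fintype ι]
  {P : Measure Ω} [IsProbabilityMeasure P] {G : Ω → β} {X : ι → Ω → ℝ}

/-- Conditional independence gives a product formula for each choice of events, with an exceptional
null set depending on the choice. Half-lines with rational endpoints form a countable π-system
generating the Borel sets, so one null set suffices and independence extends to the whole σ-field.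
-/
theorem ae_iIndepFun_condDistrib (hG : Measurable G) (hX : ∀ s, Measurable (X s))
    (hind : CondIndepGiven (mβ.comap G) P X) :
    ∀ᵐ ω ∂P, iIndepFun (fun s (x : ι → ℝ) => x s)
      (condDistrib (fun ω s => X s ω) G P (G ω)) := by
  have hXm : Measurable fun ω s => X s ω := measurable_pi_lambda _ hX
  have key : ∀ (T : Finset ι) (q : ι → ℚ), ∀ᵐ ω ∂P,
      (condDistrib (fun ω s => X s ω) G P (G ω)).real
        (⋂ s ∈ T, (fun x : ι → ℝ => x s) ⁻¹' Set.Iic (q s : ℝ)) =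
      ∏ s ∈ T, (condDistrib (fun ω s => X s ω) G P (G ω)).real
        ((fun x : ι → ℝ => x s) ⁻¹' Set.Iic (q s : ℝ)) := by
    intro T q
    have hm : ∀ s, MeasurableSet ((fun x : ι → ℝ => x s) ⁻¹' Set.Iic (q s : ℝ)) := fun s =>
      measurable_pi_apply s measurableSet_Iic
    have h1 := condDistrib_ae_eq_condExp (μ := P) hG hXm
      (Finset.measurableSet_biInter T fun s _ => hm s)
    have h2 : ∀ᵐ ω ∂P, ∀ s : ι, (condDistrib (fun ω s => X s ω) G P (G ω)).real
        ((fun x : ι → ℝ => x s) ⁻¹' Set.Iic (q s : ℝ)) =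
        (P⟦X s ⁻¹' Set.Iic (q s : ℝ) | mβ.comap G⟧) ω :=
      ae_all_iff.2 fun s => condDistrib_ae_eq_condExp (μ := P) hG hXm (hm s)
    filter_upwards [h1, h2, hind T (fun s => Set.Iic (q s : ℝ)) fun s _ => measurableSet_Iic]
      with ω h1 h2 h3
    rw [h1, Finset.prod_congr rfl fun s _ => h2 s]
    have hset : (fun ω s => X s ω) ⁻¹' (⋂ s ∈ T, (fun x : ι → ℝ => x s) ⁻¹' Set.Iic (q s : ℝ)) =
        ⋂ s ∈ T, X s ⁻¹' Set.Iic (q s : ℝ) := by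
      simp only [Set.preimage_iInter]
      rfl
    rw [hset, h3, Finset.prod_apply]
  have hall := ae_all_iff.2 fun T : Finset ι => ae_all_iff.2 fun q : ι → ℚ => key T q
  filter_upwards [hall] with ω hω
  rw [iIndepFun_iff_iIndep]
  refine iIndepSets.iIndep (fun s => (measurable_pi_apply s).comap_le)
    (fun s => {t | ∃ u ∈ (⋃ a : ℚ, {Set.Iic (a : ℝ)}), (fun x : ι → ℝ => x s) ⁻¹' u = t})
    (fun s => Real.isPiSystem_Iic_rat.comap _) (fun s => ?_) ?_
  · conv_lhs => rw [BorelSpace.measurable_eq (α := ℝ), Real.borel_eq_generateFrom_Iic_rat]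
    rw [MeasurableSpace.comap_generateFrom]
    rfl
  · rw [iIndepSets_iff]
    intro T f hf
    -- The endpoint `0` outside `T` is arbitrary; it only makes the choice of endpoints a total
    -- function.
    have hf' : ∀ s, ∃ a : ℚ, s ∈ T → f s = (fun x : ι → ℝ => x s) ⁻¹' Set.Iic (a : ℝ) := by
      intro s
      by_cases hs : s ∈ T
      · obtain ⟨u, hu, hus⟩ := hf s hs
        obtain ⟨a, rfl⟩ := Set.mem_iUnion.1 hu
        exact ⟨a, fun _ => hus.symm⟩
      · exact ⟨0, fun h => absurd h hs⟩
    choose q hq using hf'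
    have h := hω T q
    rw [Set.iInter₂_congr hq, Finset.prod_congr rfl fun s hs => by rw [hq s hs]]
    rw [← ENNReal.toReal_eq_toReal_iff' (measure_ne_top _ _)
      (ENNReal.prod_ne_top fun s _ => measure_ne_top _ _), ENNReal.toReal_prod]
    exact h

theorem ae_indepCentred_condDistrib (hG : Measurable G) (hX : ∀ s, Measurable (X s))
    (hind : CondIndepGiven (mβ.comap G) P X) {ν C : ℝ} (hν : 0 ≤ ν)
    (hC : ∀ s, CondMeanLE (mβ.comap G) P (fun ω => |X s ω| ^ (2 + ν)) C) {a : ι → β → ℝ}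
    (ha : ∀ s, P[X s | mβ.comap G] =ᵐ[P] fun ω => a s (G ω)) :
    ∀ᵐ ω ∂P, IndepCentred (condDistrib (fun ω s => X s ω) G P (G ω))
      (fun s (x : ι → ℝ) => x s - a s (G ω)) (centredBound ν C) ν := by
  have hXm : Measurable fun ω s => X s ω := measurable_pi_lambda _ hX
  have hq : 0 ≤ 2 + ν := by linarith
  have hL2 : ∀ s, MemLp (X s) 2 P := fun s =>
    integrable_sq_of_integrable_rpow (hX s).aestronglyMeasurable hν (hC s).1
  have hpm : ∀ s, StronglyMeasurable fun x : ι → ℝ => |x s| ^ (2 + ν) := fun s =>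
    ((Real.continuous_rpow_const hq).measurable.comp (measurable_pi_apply s).abs).stronglyMeasurable
  have h1 : ∀ᵐ ω ∂P, ∀ s, Integrable (fun x : ι → ℝ => |x s| ^ (2 + ν))
      (condDistrib (fun ω s => X s ω) G P (G ω)) := by
    refine ae_all_iff.2 fun s => ?_
    refine Integrable.condDistrib_ae (f := fun y : β × (ι → ℝ) => |y.2 s| ^ (2 + ν))
      hG.aemeasurable hXm.aemeasurable ?_
    exact (integrable_map_measure ((hpm s).comp_measurable measurable_snd).aestronglyMeasurable
      (hG.prodMk hXm).aemeasurable).2 (hC s).1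
  have h2 : ∀ᵐ ω ∂P, ∀ s, ∫ x : ι → ℝ, |x s| ^ (2 + ν)
      ∂(condDistrib (fun ω s => X s ω) G P (G ω)) ≤ C := by
    refine ae_all_iff.2 fun s => ?_
    filter_upwards [condExp_ae_eq_integral_condDistrib hG hXm.aemeasurable (hpm s) (hC s).1,
      (hC s).2] with ω h h'
    rw [← h]; exact h'
  have h3 : ∀ᵐ ω ∂P, ∀ s, ∫ x : ι → ℝ, x s
      ∂(condDistrib (fun ω s => X s ω) G P (G ω)) = a s (G ω) := by
    refine ae_all_iff.2 fun s => ?_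
    filter_upwards [condExp_ae_eq_integral_condDistrib hG hXm.aemeasurable
      (measurable_pi_apply s).stronglyMeasurable ((hL2 s).integrable one_le_two), ha s] with ω h h'
    rw [← h]; exact h'
  filter_upwards [ae_iIndepFun_condDistrib hG hX hind, h1, h2, h3] with ω h0 h1 h2 h3
  exact IndepCentred.of_moments hν h0 (fun s => (measurable_pi_apply s).aestronglyMeasurable)
    h1 h2 h3

/-- Under the conditional law the centring `a (G ω)` is frozen, so the conditional variance is the
second moment of the same centred family to which the unconditional bounds apply. -/
theorem condVar_ae_eq_integral_condDistrib (hG : Measurable G) (hX : ∀ s, Measurable (X s))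
    {s : ι} (hL2 : MemLp (X s) 2 P) {a : β → ℝ} (ham : Measurable a)
    (ha : P[X s | mβ.comap G] =ᵐ[P] fun ω => a (G ω)) :
    Var[X s; P | mβ.comap G] =ᵐ[P] fun ω => ∫ x : ι → ℝ, (x s - a (G ω)) ^ 2
      ∂(condDistrib (fun ω s => X s ω) G P (G ω)) := by
  have hXm : Measurable fun ω s => X s ω := measurable_pi_lambda _ hX
  have h1 : Var[X s; P | mβ.comap G] =ᵐ[P]
      P[fun ω => (X s ω - a (G ω)) ^ 2 | mβ.comap G] := by
    refine condExp_congr_ae ?_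
    filter_upwards [ha] with ω h
    simp [h]
  have haL2 : MemLp (fun ω => a (G ω)) 2 P := (hL2.condExp one_le_two).ae_eq ha
  refine h1.trans ?_
  refine condExp_prod_ae_eq_integral_condDistrib
    (f := fun y : β × (ι → ℝ) => (y.2 s - a y.1) ^ 2) hG hXm.aemeasurable ?_
    (hL2.sub haL2).integrable_sq
  exact (Measurable.pow_const (((measurable_pi_apply s).comp measurable_snd).sub
    (ham.comp measurable_fst)) 2).stronglyMeasurable

/-- The joint law is disintegrated along `G`: fibres outside `E` have conditional probability at
most `η`, and those over `E` at most one. This turns fibrewise bounds, valid when the coefficients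
are small, into unconditional ones. -/
theorem measure_le_add_of_condDistrib (hG : Measurable G) (hX : ∀ s, Measurable (X s))
    {A : Set (β × (ι → ℝ))} (hA : MeasurableSet A) {E : Set Ω} {η : ENNReal}
    (h : ∀ᵐ ω ∂P, ω ∉ E → condDistrib (fun ω s => X s ω) G P (G ω) {x | (G ω, x) ∈ A} ≤ η) :
    P {ω | (G ω, fun s => X s ω) ∈ A} ≤ P E + η := by
  have hXm : Measurable fun ω s => X s ω := measurable_pi_lambda _ hX
  have h1 : P {ω | (G ω, fun s => X s ω) ∈ A} =
      ∫⁻ ω, condDistrib (fun ω s => X s ω) G P (G ω) (Prod.mk (G ω) ⁻¹' A) ∂P := by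
    have := congrArg (fun ρ : Measure (β × (ι → ℝ)) => ρ A)
      (compProd_map_condDistrib (X := G) (μ := P) hXm.aemeasurable)
    rw [Measure.map_apply (hG.prodMk hXm) hA, Measure.compProd_apply hA,
      lintegral_map (Kernel.measurable_kernel_prodMk_left hA) hG] at this
    exact this.symm
  rw [h1]
  -- `E` is not assumed measurable, hence the measurable hull, which has the same measure.
  have h2 : ∫⁻ ω, condDistrib (fun ω s => X s ω) G P (G ω) (Prod.mk (G ω) ⁻¹' A) ∂P ≤
      ∫⁻ ω, (toMeasurable P E).indicator 1 ω + η ∂P := by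
    refine lintegral_mono_ae ?_
    filter_upwards [h] with ω hω
    by_cases hE : ω ∈ E
    · rw [Set.indicator_of_mem (subset_toMeasurable _ _ hE)]
      exact prob_le_one.trans (by simp)
    · exact (hω hE).trans le_add_self
  refine h2.trans ?_
  rw [lintegral_add_right _ measurable_const, lintegral_indicator_one (measurableSet_toMeasurable _ _),
    measure_toMeasurable]
  simp

theorem measure_abs_linear_comp_ge_le (hG : Measurable G) (hX : ∀ s, Measurable (X s))
    (hind : CondIndepGiven (mβ.comap G) P X) {ν C : ℝ} (hν : 0 ≤ ν)
    (hC : ∀ s, CondMeanLE (mβ.comap G) P (fun ω => |X s ω| ^ (2 + ν)) C) {a : ι → β → ℝ}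
    (ham : ∀ s, Measurable (a s))
    (ha : ∀ s, P[X s | mβ.comap G] =ᵐ[P] fun ω => a s (G ω))
    {c : ι → β → ℝ} (hc : ∀ s, Measurable (c s)) {ε δ : ℝ} (hε : 0 < ε) :
    P {ω | ε ≤ |∑ s, c s (G ω) * (X s ω - a s (G ω))|} ≤
      P {ω | δ ≤ ∑ s, c s (G ω) ^ 2} +
      ENNReal.ofReal (|centredBound ν C| * δ / ε ^ 2) := by
  have hA : MeasurableSet {y : β × (ι → ℝ) | ε ≤ |∑ s, c s y.1 * (y.2 s - a s y.1)|} := by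
    refine measurableSet_le measurable_const (Measurable.abs ?_)
    refine Finset.measurable_fun_sum _ fun s _ => ((hc s).comp measurable_fst).mul ?_
    exact ((measurable_pi_apply s).comp measurable_snd).sub ((ham s).comp measurable_fst)
  refine measure_le_add_of_condDistrib hG hX hA ?_
  filter_upwards [ae_indepCentred_condDistrib hG hX hind hν hC ha] with ω h hω
  refine (measure_abs_linear_ge_le h.indep h.memLp h.mean
    (fun s => (h.second s).trans (le_abs_self _)) (fun s => c s (G ω)) hε).trans ?_
  apply ENNReal.ofReal_le_ofReal
  gcongr
  simp only [not_le] at hω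
  exact hω.le

theorem measure_abs_quadratic_comp_ge_le [LinearOrder ι]
    (hG : Measurable G) (hX : ∀ s, Measurable (X s))
    (hind : CondIndepGiven (mβ.comap G) P X) {ν C : ℝ} (hν : 0 ≤ ν)
    (hC : ∀ s, CondMeanLE (mβ.comap G) P (fun ω => |X s ω| ^ (2 + ν)) C) {a : ι → β → ℝ}
    (ham : ∀ s, Measurable (a s))
    (ha : ∀ s, P[X s | mβ.comap G] =ᵐ[P] fun ω => a s (G ω))
    {v : ι → β → ℝ} (hvm : ∀ s, Measurable (v s))
    (hv : ∀ s, Var[X s; P | mβ.comap G] =ᵐ[P] fun ω => v s (G ω))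
    {M : ι → ι → β → ℝ} (hM : ∀ s t, Measurable (M s t)) {A : ℝ}
    (hMA : ∀ᵐ ω ∂P, ∑ s, |M s s (G ω)| ≤ A)
    {ε δ R : ℝ} (hε : 0 < ε) (hR : 0 < R) :
    P {ω | ε ≤ |∑ s, ∑ t, M s t (G ω) * ((X s ω - a s (G ω)) * (X t ω - a t (G ω))) -
        ∑ s, M s s (G ω) * v s (G ω)|} ≤
      P {ω | δ ≤ ∑ s, ∑ t, M s t (G ω) ^ 2} +
      (ENNReal.ofReal (|centredBound ν C| ^ 2 * δ / (ε / 3) ^ 2) +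
      ENNReal.ofReal (|centredBound ν C| ^ 2 * δ / (ε / 3) ^ 2) +
      (ENNReal.ofReal (R ^ 4 * δ / (ε / 3 / 2) ^ 2) +
      ENNReal.ofReal (2 * (|centredBound ν C| / R ^ ν) * A / (ε / 3 / 2)))) := by
  have hsub : ∀ s, Measurable fun y : β × (ι → ℝ) => y.2 s - a s y.1 := fun s =>
    ((measurable_pi_apply s).comp measurable_snd).sub ((ham s).comp measurable_fst)
  have hmeas : MeasurableSet {y : β × (ι → ℝ) |
      ε ≤ |∑ s, ∑ t, M s t y.1 * ((y.2 s - a s y.1) * (y.2 t - a t y.1)) -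
        ∑ s, M s s y.1 * v s y.1|} := by
    refine measurableSet_le measurable_const (Measurable.abs (Measurable.sub ?_ ?_))
    · exact Finset.measurable_fun_sum _ fun s _ => Finset.measurable_fun_sum _ fun t _ =>
        ((hM s t).comp measurable_fst).mul ((hsub s).mul (hsub t))
    · exact Finset.measurable_fun_sum _ fun s _ =>
        ((hM s s).comp measurable_fst).mul ((hvm s).comp measurable_fst)
  refine measure_le_add_of_condDistrib hG hX hmeas ?_
  have hvar : ∀ᵐ ω ∂P, ∀ s, v s (G ω) = ∫ x : ι → ℝ, (x s - a s (G ω)) ^ 2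
      ∂(condDistrib (fun ω s => X s ω) G P (G ω)) := by
    refine ae_all_iff.2 fun s => ?_
    filter_upwards [hv s, condVar_ae_eq_integral_condDistrib hG hX
      (integrable_sq_of_integrable_rpow (hX s).aestronglyMeasurable hν (hC s).1) (ham s) (ha s)]
      with ω h1 h2
    rw [← h1, h2]
  filter_upwards [ae_indepCentred_condDistrib hG hX hind hν hC ha, hvar, hMA] with ω h hv hA hω
  simp only [not_le] at hω
  have hb := measure_abs_quadratic_ge_le h.indep h.memLp h.mean
    (fun s => (h.second s).trans (le_abs_self _)) (τ := |centredBound ν C| / R ^ ν)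
    (fun s => (h.tail s R hR).trans (by gcongr; exact le_abs_self _))
    (fun s t => M s t (G ω)) hε
  simp only [← hv] at hb
  refine hb.trans ?_
  gcongr

end ConditionalLaw

/-! ### Concentration conditional on a sub-σ-field -/

section ConditionalBounds

variable {Ω ι : Type*} {m mΩ : MeasurableSpace Ω} [Fintype ι]
  {P : Measure Ω} [IsProbabilityMeasure P] {X : ι → Ω → ℝ}

theorem measure_abs_condLinear_ge_le (hm : m ≤ mΩ) (hX : ∀ s, Measurable (X s))
    (hind : CondIndepGiven m P X) {ν C : ℝ} (hν : 0 ≤ ν)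
    (hC : ∀ s, CondMeanLE m P (fun ω => |X s ω| ^ (2 + ν)) C) {a : ι → Ω → ℝ}
    (ham : ∀ s, Measurable[m] (a s)) (ha : ∀ s, P[X s | m] =ᵐ[P] a s)
    {c : ι → Ω → ℝ} (hc : ∀ s, Measurable[m] (c s)) {ε δ : ℝ} (hε : 0 < ε) :
    P {ω | ε ≤ |∑ s, c s ω * (X s ω - a s ω)|} ≤ P {ω | δ ≤ ∑ s, c s ω ^ 2} +
      ENNReal.ofReal (|centredBound ν C| * δ / ε ^ 2) := by
  -- Conditioning on `m` is conditioning on the identity map into `Ω` equipped with `m`. Only the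
  -- space `ι → ℝ` of shifters has to be standard Borel, so `Ω` is unrestricted.
  have hcomap : m.comap id = m := MeasurableSpace.comap_id
  exact measure_abs_linear_comp_ge_le (mβ := m) (G := id) (measurable_id'' hm) hX
    (by rwa [hcomap]) hν (by rwa [hcomap]) ham (by rwa [hcomap]) hc hε

theorem measure_abs_condQuadratic_ge_le [LinearOrder ι] (hm : m ≤ mΩ)
    (hX : ∀ s, Measurable (X s)) (hind : CondIndepGiven m P X) {ν C : ℝ} (hν : 0 ≤ ν)
    (hC : ∀ s, CondMeanLE m P (fun ω => |X s ω| ^ (2 + ν)) C) {a : ι → Ω → ℝ}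
    (ham : ∀ s, Measurable[m] (a s)) (ha : ∀ s, P[X s | m] =ᵐ[P] a s)
    {M : ι → ι → Ω → ℝ} (hM : ∀ s t, Measurable[m] (M s t)) {A : ℝ}
    (hMA : ∀ᵐ ω ∂P, ∑ s, |M s s ω| ≤ A) {ε δ R : ℝ} (hε : 0 < ε) (hR : 0 < R) :
    P {ω | ε ≤ |∑ s, ∑ t, M s t ω * ((X s ω - a s ω) * (X t ω - a t ω)) -
        ∑ s, M s s ω * Var[X s; P | m] ω|} ≤
      P {ω | δ ≤ ∑ s, ∑ t, M s t ω ^ 2} +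
      (ENNReal.ofReal (|centredBound ν C| ^ 2 * δ / (ε / 3) ^ 2) +
      ENNReal.ofReal (|centredBound ν C| ^ 2 * δ / (ε / 3) ^ 2) +
      (ENNReal.ofReal (R ^ 4 * δ / (ε / 3 / 2) ^ 2) +
      ENNReal.ofReal (2 * (|centredBound ν C| / R ^ ν) * A / (ε / 3 / 2)))) := by
  have hcomap : m.comap id = m := MeasurableSpace.comap_id
  exact measure_abs_quadratic_comp_ge_le (mβ := m) (G := id) (measurable_id'' hm) hX
    (by rwa [hcomap]) hν (by rwa [hcomap]) ham (by rwa [hcomap])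
    (v := fun s => Var[X s; P | m]) (fun s => stronglyMeasurable_condVar.measurable)
    (fun s => by rw [hcomap]; rfl) hM hMA hε hR

end ConditionalBounds

/-! ### Calculus of convergence and boundedness in probability -/

section InProbability

variable {Ω : ℕ → Type*} [∀ S, MeasurableSpace (Ω S)] {P : ∀ S, Measure (Ω S)}
  {A B : ∀ S, Ω S → ℝ} {a b : ℝ}

/-- Boundedness in probability (tightness) of a triangular array. -/
def BddInProb (P : ∀ S, Measure (Ω S)) (A : ∀ S, Ω S → ℝ) : Prop :=
  ∀ η : ENNReal, 0 < η → ∃ M : ℝ, 0 < M ∧ ∀ᶠ S in atTop, P S {ω | M ≤ |A S ω|} ≤ η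

/-- Convergence in probability is preserved by functions continuous at the limit. -/
theorem ConvInProb.comp_continuousAt {ι : Type*} [Fintype ι] {A : ι → ∀ S, Ω S → ℝ} {a : ι → ℝ}
    (hA : ∀ i, ConvInProb P (A i) (a i)) {f : (ι → ℝ) → ℝ} (hf : ContinuousAt f a) :
    ConvInProb P (fun S ω => f fun i => A i S ω) (f a) := by
  intro ε hε
  obtain ⟨δ, hδ, hfδ⟩ := Metric.continuousAt_iff.1 hf ε hε
  have hlim : Tendsto (fun S => ∑ i, P S {ω | δ ≤ |A i S ω - a i|}) atTop (𝓝 0) := by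
    have := tendsto_finsetSum (Finset.univ : Finset ι) fun i _ => hA i δ hδ
    simpa using this
  refine tendsto_of_tendsto_of_tendsto_of_le_of_le tendsto_const_nhds hlim (fun S => zero_le)
    fun S => ?_
  refine (measure_mono ?_).trans (measure_iUnion_fintype_le (P S) _)
  intro ω hω
  by_contra hcon
  simp only [Set.mem_iUnion, Set.mem_ofPred_eq, not_exists, not_le] at hcon
  have := hfδ ((dist_pi_lt_iff hδ).2 fun i => by rw [Real.dist_eq]; exact hcon i)
  rw [Real.dist_eq] at this
  exact absurd hω (not_le.2 this)

theorem ConvInProb.congr_of_tendsto (hA : ConvInProb P A a)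
    (h : Tendsto (fun S => P S {ω | A S ω ≠ B S ω}) atTop (𝓝 0)) : ConvInProb P B a := by
  intro ε hε
  have hlim := h.add (hA ε hε)
  rw [add_zero] at hlim
  refine tendsto_of_tendsto_of_tendsto_of_le_of_le tendsto_const_nhds hlim (fun S => zero_le)
    fun S => (measure_mono ?_).trans (measure_union_le _ _)
  intro ω hω
  by_cases h : A S ω = B S ω
  · right
    simp only [Set.mem_ofPred_eq] at hω ⊢
    rwa [h]
  · exact Or.inl h

theorem ConvInProb.congr_ae (hA : ConvInProb P A a) (h : ∀ᶠ S in atTop, A S =ᵐ[P S] B S) :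
    ConvInProb P B a := by
  refine hA.congr_of_tendsto (tendsto_const_nhds.congr' ?_)
  filter_upwards [h] with S hS
  exact (ae_iff.1 hS).symm

theorem ConvInProb.congr (hA : ConvInProb P A a) (h : ∀ S ω, A S ω = B S ω) :
    ConvInProb P B a :=
  hA.congr_ae (Eventually.of_forall fun S => Eventually.of_forall (h S))

theorem ConvInProb.of_abs_le (hA : ConvInProb P A 0) (h : ∀ S, ∀ᵐ ω ∂P S, |B S ω| ≤ |A S ω|) :
    ConvInProb P B 0 := by
  intro ε hε
  refine tendsto_of_tendsto_of_tendsto_of_le_of_le tendsto_const_nhds (hA ε hε)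
    (fun S => zero_le) fun S => measure_mono_ae ?_
  filter_upwards [h S] with ω hω hε'
  simp only [sub_zero] at hε' ⊢
  exact le_trans hε' hω

theorem ConvInProb.add (hA : ConvInProb P A a) (hB : ConvInProb P B b) :
    ConvInProb P (fun S ω => A S ω + B S ω) (a + b) :=
  ConvInProb.comp_continuousAt (A := fun i : Bool => bif i then A else B)
    (a := fun i => bif i then a else b) (by rintro (_ | _); exacts [hB, hA])
    (f := fun x => x true + x false) (by fun_prop)

theorem ConvInProb.sub (hA : ConvInProb P A a) (hB : ConvInProb P B b) :
    ConvInProb P (fun S ω => A S ω - B S ω) (a - b) :=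
  ConvInProb.comp_continuousAt (A := fun i : Bool => bif i then A else B)
    (a := fun i => bif i then a else b) (by rintro (_ | _); exacts [hB, hA])
    (f := fun x => x true - x false) (by fun_prop)

theorem ConvInProb.inv (hA : ConvInProb P A a) (ha : a ≠ 0) :
    ConvInProb P (fun S ω => (A S ω)⁻¹) a⁻¹ :=
  ConvInProb.comp_continuousAt (A := fun _ : Unit => A) (a := fun _ => a) (fun _ => hA)
    (f := fun x => (x ())⁻¹) ((continuousAt_apply () _).inv₀ ha)

theorem ConvInProb.const_mul (hA : ConvInProb P A a) (c : ℝ) :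
    ConvInProb P (fun S ω => c * A S ω) (c * a) :=
  ConvInProb.comp_continuousAt (A := fun _ : Unit => A) (a := fun _ => a) (fun _ => hA)
    (f := fun x => c * x ()) (continuousAt_const.mul (continuousAt_apply () _))

theorem ConvInProb.sum_zero {ι : Type*} [Fintype ι] {A : ι → ∀ S, Ω S → ℝ}
    (hA : ∀ i, ConvInProb P (A i) 0) : ConvInProb P (fun S ω => ∑ i, A i S ω) 0 := by
  have := ConvInProb.comp_continuousAt (a := fun _ => 0) hA (f := fun x => ∑ i, x i)
    (by fun_prop)
  simpa using this

theorem ConvInProb.of_sq (hA : ConvInProb P (fun S ω => A S ω ^ 2) 0) : ConvInProb P A 0 := by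
  intro ε hε
  refine tendsto_of_tendsto_of_tendsto_of_le_of_le tendsto_const_nhds (hA (ε ^ 2) (by positivity))
    (fun S => zero_le) fun S => measure_mono ?_
  intro ω hω
  simp only [sub_zero, Set.mem_ofPred_eq] at hω ⊢
  rw [abs_of_nonneg (sq_nonneg _), ← sq_abs (A S ω)]
  gcongr

/-- A triangular array with a positive limit in probability is positive with probability
approaching one. -/
theorem ConvInProb.tendsto_measure_not_pos (hA : ConvInProb P A a) (ha : 0 < a) :
    Tendsto (fun S => P S {ω | ¬ 0 < A S ω}) atTop (𝓝 0) := by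
  refine tendsto_of_tendsto_of_tendsto_of_le_of_le tendsto_const_nhds (hA a ha)
    (fun S => zero_le) fun S => measure_mono ?_
  intro ω hω
  simp only [Set.mem_ofPred_eq, not_lt] at hω ⊢
  rw [abs_sub_comm]
  exact le_trans (by linarith) (le_abs_self _)

theorem ConvInProb.bddInProb (hA : ConvInProb P A a) : BddInProb P A := by
  intro η hη
  refine ⟨|a| + 1, by positivity, ?_⟩
  filter_upwards [(hA 1 one_pos).eventually_le_const hη] with S hS
  refine (measure_mono ?_).trans hS
  intro ω hω
  simp only [Set.mem_ofPred_eq] at hω ⊢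
  have := abs_sub_abs_le_abs_sub (A S ω) a
  linarith

theorem BddInProb.of_abs_le (hA : BddInProb P A) (h : ∀ S, ∀ᵐ ω ∂P S, |B S ω| ≤ |A S ω|) :
    BddInProb P B := by
  intro η hη
  obtain ⟨M, hM0, hM⟩ := hA η hη
  refine ⟨M, hM0, ?_⟩
  filter_upwards [hM] with S hS
  refine (measure_mono_ae ?_).trans hS
  filter_upwards [h S] with ω hω hM'
  exact le_trans hM' hω

theorem BddInProb.add (hA : BddInProb P A) (hB : BddInProb P B) :
    BddInProb P (fun S ω => A S ω + B S ω) := by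
  intro η hη
  obtain ⟨M, hM0, hM⟩ := hA (η / 2) (ENNReal.half_pos hη.ne')
  obtain ⟨M', hM0', hM'⟩ := hB (η / 2) (ENNReal.half_pos hη.ne')
  refine ⟨M + M', by positivity, ?_⟩
  filter_upwards [hM, hM'] with S hS hS'
  rw [← ENNReal.add_halves η]
  refine (measure_mono ?_).trans ((measure_union_le _ _).trans (add_le_add hS hS'))
  intro ω hω
  by_contra! hcon
  simp only [Set.mem_union, Set.mem_ofPred_eq, not_or, not_le] at hcon hω
  linarith [abs_add_le (A S ω) (B S ω), hcon.1, hcon.2]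

theorem BddInProb.const_mul (hA : BddInProb P A) (c : ℝ) :
    BddInProb P (fun S ω => c * A S ω) := by
  intro η hη
  obtain ⟨M, hM0, hM⟩ := hA η hη
  -- Using `|c| + 1` keeps the bound positive when `c = 0`.
  refine ⟨(|c| + 1) * M, by positivity, ?_⟩
  filter_upwards [hM] with S hS
  refine (measure_mono ?_).trans hS
  intro ω hω
  simp only [Set.mem_ofPred_eq, abs_mul] at hω ⊢
  by_contra! hcon
  nlinarith [abs_nonneg c, abs_nonneg (A S ω)]

theorem ConvInProb.mul_bddInProb (hA : ConvInProb P A 0) (hB : BddInProb P B) :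
    ConvInProb P (fun S ω => A S ω * B S ω) 0 := by
  intro ε hε
  rw [ENNReal.tendsto_nhds_zero]
  intro η hη
  obtain ⟨M, hM0, hM⟩ := hB (η / 2) (ENNReal.half_pos hη.ne')
  filter_upwards [hM, (hA (ε / M) (by positivity)).eventually_le_const (ENNReal.half_pos hη.ne')]
    with S hS hS'
  rw [← ENNReal.add_halves η]
  refine (measure_mono ?_).trans ((measure_union_le _ _).trans (add_le_add hS' hS))
  intro ω hω
  by_contra! hcon
  simp only [Set.mem_union, Set.mem_ofPred_eq, not_or, not_le, sub_zero, abs_mul] at hcon hω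
  have h1 : |A S ω| * |B S ω| < ε / M * M :=
    mul_lt_mul'' hcon.1 hcon.2 (abs_nonneg _) (abs_nonneg _)
  rw [div_mul_cancel₀ _ hM0.ne'] at h1
  linarith

theorem ConvInProb.of_integral_abs [∀ S, IsProbabilityMeasure (P S)]
    (h_int : ∀ S, Integrable (A S) (P S))
    {r : ℕ → ℝ} (hle : ∀ S, ∫ ω, |A S ω| ∂P S ≤ r S) (hr : Tendsto r atTop (𝓝 0)) :
    ConvInProb P A 0 := by
  intro ε hε
  have hlim : Tendsto (fun S => ENNReal.ofReal (r S / ε)) atTop (𝓝 0) := by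
    have := ENNReal.tendsto_ofReal (hr.div_const ε)
    simpa using this
  refine tendsto_of_tendsto_of_tendsto_of_le_of_le tendsto_const_nhds hlim (fun S => zero_le)
    fun S => ?_
  simp only [sub_zero]
  refine (measure_abs_ge_le_of_integral_abs (h_int S) hε).trans (ENNReal.ofReal_le_ofReal ?_)
  gcongr
  exact hle S

theorem BddInProb.of_integral_abs [∀ S, IsProbabilityMeasure (P S)]
    (h_int : ∀ S, Integrable (A S) (P S)) {C : ℝ} (hle : ∀ S, ∫ ω, |A S ω| ∂P S ≤ C) :
    BddInProb P A := by
  intro η hη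
  have hlim : Tendsto (fun M : ℝ => ENNReal.ofReal (C / M)) atTop (𝓝 0) := by
    have := ENNReal.tendsto_ofReal (tendsto_const_nhds (x := C).div_atTop tendsto_id)
    simpa using this
  obtain ⟨M, hM, hM0⟩ := ((hlim.eventually_le_const hη).and (eventually_gt_atTop 0)).exists
  refine ⟨M, hM0, Eventually.of_forall fun S => ?_⟩
  refine (measure_abs_ge_le_of_integral_abs (h_int S) hM0).trans
    (le_trans (ENNReal.ofReal_le_ofReal ?_) hM)
  gcongr
  exact hle S

/-- By Cramer's rule the entries of the inverse are polynomials in the entries divided by the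
determinant. -/
theorem Matrix.continuousAt_inv_apply {p : ℕ} {Q : Matrix (Fin p) (Fin p) ℝ} (hQ : Q.det ≠ 0)
    (k l : Fin p) : ContinuousAt (fun A : Matrix (Fin p) (Fin p) ℝ => A⁻¹ k l) Q := by
  have h : (fun A : Matrix (Fin p) (Fin p) ℝ => A⁻¹ k l) = fun A => A.det⁻¹ * A.adjugate k l := by
    funext A
    rw [Matrix.inv_def, Matrix.smul_apply, Ring.inverse_eq_inv', smul_eq_mul]
  rw [h]
  have h1 : Continuous fun A : Matrix (Fin p) (Fin p) ℝ => A.det := continuous_id.matrix_det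
  have h2 : Continuous fun A : Matrix (Fin p) (Fin p) ℝ => A.adjugate k l :=
    (continuous_id.matrix_adjugate).matrix_elem k l
  exact (h1.continuousAt.inv₀ hQ).mul h2.continuousAt

/-- Continuous mapping for matrices converging entrywise in probability. -/
theorem ConvInProb.comp_matrix {p : ℕ} {A : ∀ S, Ω S → Matrix (Fin p) (Fin p) ℝ}
    {Q : Matrix (Fin p) (Fin p) ℝ} (hA : ∀ k l, ConvInProb P (fun S ω => A S ω k l) (Q k l))
    {f : Matrix (Fin p) (Fin p) ℝ → ℝ} (hf : ContinuousAt f Q) :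
    ConvInProb P (fun S ω => f (A S ω)) (f Q) := by
  obtain ⟨g, hg, hgM⟩ : ∃ g : (Fin p × Fin p → ℝ) → Matrix (Fin p) (Fin p) ℝ,
      Continuous g ∧ ∀ M : Matrix (Fin p) (Fin p) ℝ, g (fun i => M i.1 i.2) = M :=
    ⟨fun x => Matrix.of fun k l => x (k, l), continuous_matrix fun k l => continuous_apply (k, l),
      fun M => Matrix.ext fun k l => rfl⟩
  have hfg : ContinuousAt (fun x => f (g x)) (fun i => Q i.1 i.2) := by
    refine ContinuousAt.comp' ?_ hg.continuousAt
    rw [hgM]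
    exact hf
  have h : ConvInProb P (fun S ω => f (g fun i => A S ω i.1 i.2)) (f (g fun i => Q i.1 i.2)) :=
    ConvInProb.comp_continuousAt (A := fun (i : Fin p × Fin p) S ω => A S ω i.1 i.2)
      (fun i => hA i.1 i.2) hfg
  rw [hgM] at h
  exact h.congr fun S ω => by rw [hgM]

end InProbability

/-! ### Deterministic inequalities for the shares -/

section Shares

variable {N S : ℕ} {w : Fin N → Fin S → ℝ}

theorem sum_share_le_iSup (s : Fin S) : ∑ i, w i s ≤ ⨆ t, ∑ i, w i t :=
  le_ciSup (Set.finite_range fun t => ∑ i, w i t).bddAbove s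

theorem iSup_share_nonneg (hw : ∀ i s, 0 ≤ w i s) : 0 ≤ ⨆ t, ∑ i, w i t :=
  Real.iSup_nonneg fun t => Finset.sum_nonneg fun i _ => hw i t

/-- Cauchy-Schwarz with weights `w i s` bounds `(∑_i w_is g_i)²` by `n_s ∑_i w_is g_i²`. Pulling out
`max n_s` and summing over sectors first uses that the shares of a region sum to at most one. -/
theorem sum_sq_share_avg_le (hw : ∀ i s, 0 ≤ w i s) (hsum : ∀ i, ∑ s, w i s ≤ 1)
    (g : Fin N → ℝ) :
    ∑ s, ((∑ i, w i s * g i) / N) ^ 2 ≤ ((⨆ s, ∑ i, w i s) / N) * ((∑ i, g i ^ 2) / N) := by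
  have h1 : ∀ s, (∑ i, w i s * g i) ^ 2 ≤ (⨆ t, ∑ i, w i t) * ∑ i, w i s * g i ^ 2 := by
    intro s
    have hn : 0 ≤ ∑ i, w i s * g i ^ 2 :=
      Finset.sum_nonneg fun i _ => mul_nonneg (hw i s) (sq_nonneg _)
    refine (Finset.sum_sq_le_sum_mul_sum_of_sq_le_mul Finset.univ (fun i _ => hw i s)
      (fun i _ => mul_nonneg (hw i s) (sq_nonneg (g i))) fun i _ => le_of_eq (by ring)).trans ?_
    exact mul_le_mul_of_nonneg_right (sum_share_le_iSup s) hn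
  have h2 : ∑ s, ∑ i, w i s * g i ^ 2 ≤ ∑ i, g i ^ 2 := by
    rw [Finset.sum_comm]
    refine Finset.sum_le_sum fun i _ => ?_
    rw [← Finset.sum_mul]
    exact mul_le_of_le_one_left (sq_nonneg _) (hsum i)
  have h3 : ∑ s, (∑ i, w i s * g i) ^ 2 ≤ (⨆ t, ∑ i, w i t) * ∑ i, g i ^ 2 := by
    refine (Finset.sum_le_sum fun s _ => h1 s).trans ?_
    rw [← Finset.mul_sum]
    exact mul_le_mul_of_nonneg_left h2 (iSup_share_nonneg hw)
  simp_rw [div_pow]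
  rw [← Finset.sum_div, div_mul_div_comm, ← sq]
  gcongr

theorem share_le_one (hw : ∀ i s, 0 ≤ w i s) (hsum : ∀ i, ∑ s, w i s ≤ 1) (i : Fin N)
    (s : Fin S) : w i s ≤ 1 :=
  (Finset.single_le_sum (fun t _ => hw i t) (Finset.mem_univ s)).trans (hsum i)

theorem sum_sum_share_mul_le_one (hw : ∀ i s, 0 ≤ w i s) (hsum : ∀ i, ∑ s, w i s ≤ 1) :
    ∑ t, ∑ s, (∑ i, w i t * w i s) / N ≤ 1 := by
  have h1 : ∑ t, ∑ s, ∑ i, w i t * w i s ≤ N := by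
    have : ∑ t, ∑ s, ∑ i, w i t * w i s = ∑ i, (∑ t, w i t) * ∑ s, w i s := by
      simp_rw [Finset.sum_mul_sum]
      rw [Finset.sum_comm' (t' := Finset.univ) (s' := fun _ => Finset.univ) (by simp)]
      rw [Finset.sum_congr rfl fun s _ => Finset.sum_comm, Finset.sum_comm]
      refine Finset.sum_congr rfl fun i _ => ?_
      rw [Finset.sum_comm]
    rw [this]
    calc ∑ i, (∑ t, w i t) * ∑ s, w i s ≤ ∑ _i : Fin N, (1 : ℝ) :=
          Finset.sum_le_sum fun i _ => mul_le_one₀ (hsum i)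
            (Finset.sum_nonneg fun s _ => hw i s) (hsum i)
      _ = N := by simp
  simp_rw [← Finset.sum_div]
  exact div_le_one_of_le₀ h1 (Nat.cast_nonneg _)

theorem abs_sum_share_mul_le (hw : ∀ i s, 0 ≤ w i s) {b : Fin N → Fin S → ℝ} {K : ℝ}
    (hb : ∀ i s, |b i s| ≤ K) (t s : Fin S) :
    |(∑ i, w i t * w i s * b i s) / N| ≤ K * ((∑ i, w i t * w i s) / N) := by
  rw [abs_div, Nat.abs_cast, ← mul_div_assoc, Finset.mul_sum]
  gcongr
  refine (Finset.abs_sum_le_sum_abs _ _).trans (Finset.sum_le_sum fun i _ => ?_)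
  have := mul_nonneg (hw i t) (hw i s)
  rw [abs_mul, abs_of_nonneg this, mul_comm]
  exact mul_le_mul_of_nonneg_right (hb i s) this

/-- Up to the factor `K`, every entry is dominated by `∑_i w_it w_is / N`. These numbers are at most
`max n_s / N` and have total mass at most one, so their sum of squares is at most the largest entry.
-/
theorem sum_sum_sq_share_mul_le (hw : ∀ i s, 0 ≤ w i s) (hsum : ∀ i, ∑ s, w i s ≤ 1)
    {b : Fin N → Fin S → ℝ} {K : ℝ} (hb : ∀ i s, |b i s| ≤ K) :
    ∑ t, ∑ s, ((∑ i, w i t * w i s * b i s) / N) ^ 2 ≤ K ^ 2 * ((⨆ s, ∑ i, w i s) / N) := by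
  have hV : 0 ≤ (⨆ s, ∑ i, w i s) / N := div_nonneg (iSup_share_nonneg hw) (Nat.cast_nonneg _)
  have h1 : ∀ t s, ((∑ i, w i t * w i s * b i s) / N) ^ 2 ≤
      K ^ 2 * ((⨆ s, ∑ i, w i s) / N) * ((∑ i, w i t * w i s) / N) := by
    intro t s
    have hm : 0 ≤ (∑ i, w i t * w i s) / N :=
      div_nonneg (Finset.sum_nonneg fun i _ => mul_nonneg (hw i t) (hw i s)) (Nat.cast_nonneg _)
    have hmV : (∑ i, w i t * w i s) / N ≤ (⨆ s, ∑ i, w i s) / N := by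
      gcongr
      refine le_trans (Finset.sum_le_sum fun i _ => ?_) (sum_share_le_iSup t)
      exact mul_le_of_le_one_right (hw i t) (share_le_one hw hsum i s)
    rw [← sq_abs]
    calc |(∑ i, w i t * w i s * b i s) / N| ^ 2 ≤ (K * ((∑ i, w i t * w i s) / N)) ^ 2 := by
          gcongr; exact abs_sum_share_mul_le hw hb t s
      _ = K ^ 2 * (((∑ i, w i t * w i s) / N) * ((∑ i, w i t * w i s) / N)) := by ring
      _ ≤ K ^ 2 * (((⨆ s, ∑ i, w i s) / N) * ((∑ i, w i t * w i s) / N)) := by gcongr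
      _ = _ := by ring
  refine (Finset.sum_le_sum fun t _ => Finset.sum_le_sum fun s _ => h1 t s).trans ?_
  simp_rw [← Finset.mul_sum]
  exact mul_le_of_le_one_right (by positivity) (sum_sum_share_mul_le_one hw hsum)

theorem sum_abs_share_sq_le (hw : ∀ i s, 0 ≤ w i s) (hsum : ∀ i, ∑ s, w i s ≤ 1)
    {b : Fin N → Fin S → ℝ} {K : ℝ} (hK : 0 ≤ K) (hb : ∀ i s, |b i s| ≤ K) :
    ∑ s, |(∑ i, w i s * w i s * b i s) / N| ≤ K := by
  refine (Finset.sum_le_sum fun s _ => abs_sum_share_mul_le hw hb s s).trans ?_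
  rw [← Finset.mul_sum]
  refine mul_le_of_le_one_right hK (le_trans (Finset.sum_le_sum fun s _ => ?_)
    (sum_sum_share_mul_le_one hw hsum))
  exact Finset.single_le_sum (f := fun t => (∑ i, w i s * w i t) / (N : ℝ))
    (fun t _ => div_nonneg (Finset.sum_nonneg fun i _ => mul_nonneg (hw i s) (hw i t))
      (Nat.cast_nonneg _)) (Finset.mem_univ s)

theorem sq_weighted_sum_le {w b x : Fin S → ℝ} (hw : ∀ s, 0 ≤ w s) (hsum : ∑ s, w s ≤ 1) {K : ℝ}
    (hb : ∀ s, |b s| ≤ K) : (∑ s, w s * x s * b s) ^ 2 ≤ K ^ 2 * ∑ s, w s * x s ^ 2 := by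
  have hn : 0 ≤ ∑ s, w s * (x s * b s) ^ 2 :=
    Finset.sum_nonneg fun s _ => mul_nonneg (hw s) (sq_nonneg _)
  refine (Finset.sum_sq_le_sum_mul_sum_of_sq_le_mul Finset.univ (fun s _ => hw s)
    (fun s _ => mul_nonneg (hw s) (sq_nonneg (x s * b s))) fun s _ => le_of_eq (by ring)).trans ?_
  refine (mul_le_of_le_one_left hn hsum).trans ?_
  rw [Finset.mul_sum]
  refine Finset.sum_le_sum fun s _ => ?_
  have h1 : b s ^ 2 ≤ K ^ 2 := by
    rw [← sq_abs]
    exact pow_le_pow_left₀ (abs_nonneg _) (hb s) 2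
  calc w s * (x s * b s) ^ 2 = (w s * x s ^ 2) * b s ^ 2 := by ring
    _ ≤ (w s * x s ^ 2) * K ^ 2 :=
      mul_le_mul_of_nonneg_left h1 (mul_nonneg (hw s) (sq_nonneg _))
    _ = _ := by ring

end Shares

theorem integral_abs_mul_le_sqrt {Ω : Type*} [MeasurableSpace Ω] {P : Measure Ω} {f g : Ω → ℝ} (hf : MemLp f 2 P) (hg : MemLp g 2 P) :
    ∫ ω, |f ω * g ω| ∂P ≤ √(∫ ω, f ω ^ 2 ∂P) * √(∫ ω, g ω ^ 2 ∂P) := by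
  have h := integral_mul_norm_le_Lp_mul_Lq (μ := P) Real.HolderConjugate.two_two
    (f := f) (g := g) (by simpa using hf) (by simpa using hg)
  simp only [Real.norm_eq_abs, Real.rpow_two, sq_abs, ← Real.sqrt_eq_rpow] at h
  simpa only [abs_mul] using h

/-! ### Second moments of share-weighted sums -/

section WeightedMoments

variable {Ω : Type*} {m mΩ : MeasurableSpace Ω} {P : Measure Ω} [IsProbabilityMeasure P] {S : ℕ}

theorem CondMeanLE.integral_le (hm : m ≤ mΩ) {f : Ω → ℝ} {C : ℝ} (h : CondMeanLE m P f C) :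
    ∫ ω, f ω ∂P ≤ C := by
  rw [← integral_condExp hm]
  refine (integral_mono_ae integrable_condExp (integrable_const C) h.2).trans ?_
  simp

/-- The weights are `m`-measurable and can be pulled out of the conditional mean. The bound does not
grow with the number of sectors because the weights sum to at most one. -/
theorem integral_weighted_sum_le (hm : m ≤ mΩ) {w f : Fin S → Ω → ℝ} {C : ℝ}
    (hw : ∀ s, Measurable[m] (w s)) (hw0 : ∀ᵐ ω ∂P, ∀ s, 0 ≤ w s ω)
    (hw1 : ∀ᵐ ω ∂P, ∑ s, w s ω ≤ 1) (hf : ∀ s, CondMeanLE m P (f s) C) :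
    Integrable (fun ω => ∑ s, w s ω * f s ω) P ∧ ∫ ω, ∑ s, w s ω * f s ω ∂P ≤ |C| := by
  have hb : ∀ s, ∀ᵐ ω ∂P, ‖w s ω‖ ≤ 1 := by
    intro s
    filter_upwards [hw0, hw1] with ω h0 h1
    rw [Real.norm_of_nonneg (h0 s)]
    exact (Finset.single_le_sum (fun t _ => h0 t) (Finset.mem_univ s)).trans h1
  have hwm : ∀ s, AEStronglyMeasurable (w s) P := fun s =>
    ((hw s).mono hm le_rfl).aestronglyMeasurable
  have hi : ∀ s, Integrable (fun ω => w s ω * f s ω) P := fun s => (hf s).1.bdd_mul (hwm s) (hb s)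
  have hi' : ∀ s, Integrable (fun ω => w s ω * (P[f s | m]) ω) P := fun s =>
    integrable_condExp.bdd_mul (hwm s) (hb s)
  have heq : ∀ s, ∫ ω, w s ω * f s ω ∂P = ∫ ω, w s ω * (P[f s | m]) ω ∂P := by
    intro s
    rw [← integral_condExp hm]
    exact integral_congr_ae
      (condExp_stronglyMeasurable_mul_of_bound hm (hw s).stronglyMeasurable (hf s).1 1 (hb s))
  refine ⟨integrable_finsetSum _ fun s _ => hi s, ?_⟩
  rw [integral_finsetSum _ fun s _ => hi s, Finset.sum_congr rfl fun s _ => heq s,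
    ← integral_finsetSum _ fun s _ => hi' s]
  have : ∫ ω, ∑ s, w s ω * (P[f s | m]) ω ∂P ≤ ∫ _, |C| ∂P := by
    refine integral_mono_ae (integrable_finsetSum _ fun s _ => hi' s) (integrable_const _) ?_
    filter_upwards [hw0, hw1, ae_all_iff.2 fun s => (hf s).2] with ω h0 h1 h2
    calc ∑ s, w s ω * (P[f s | m]) ω ≤ ∑ s, w s ω * |C| :=
          Finset.sum_le_sum fun s _ =>
            mul_le_mul_of_nonneg_left ((h2 s).trans (le_abs_self _)) (h0 s)
      _ = (∑ s, w s ω) * |C| := by rw [Finset.sum_mul]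
      _ ≤ |C| := mul_le_of_le_one_left (abs_nonneg _) h1
  simpa using this

theorem memLp_weighted_sum (hm : m ≤ mΩ) {w x b : Fin S → Ω → ℝ} {C K : ℝ}
    (hw : ∀ s, Measurable[m] (w s)) (hw0 : ∀ᵐ ω ∂P, ∀ s, 0 ≤ w s ω)
    (hw1 : ∀ᵐ ω ∂P, ∑ s, w s ω ≤ 1) (hx : ∀ s, Measurable (x s)) (hbm : ∀ s, Measurable (b s))
    (hb : ∀ᵐ ω ∂P, ∀ s, |b s ω| ≤ K)
    (hC : ∀ s, CondMeanLE m P (fun ω => x s ω ^ 2) C) :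
    MemLp (fun ω => ∑ s, w s ω * x s ω * b s ω) 2 P ∧
      ∫ ω, (∑ s, w s ω * x s ω * b s ω) ^ 2 ∂P ≤ K ^ 2 * |C| := by
  obtain ⟨hi, hle⟩ := integral_weighted_sum_le hm hw hw0 hw1 hC
  have hmeas : Measurable fun ω => ∑ s, w s ω * x s ω * b s ω :=
    Finset.measurable_fun_sum _ fun s _ => (((hw s).mono hm le_rfl).mul (hx s)).mul (hbm s)
  have hpt : ∀ᵐ ω ∂P, (∑ s, w s ω * x s ω * b s ω) ^ 2 ≤ K ^ 2 * ∑ s, w s ω * x s ω ^ 2 := by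
    filter_upwards [hw0, hw1, hb] with ω h0 h1 h2
    exact sq_weighted_sum_le h0 h1 h2
  have hsq : Integrable (fun ω => (∑ s, w s ω * x s ω * b s ω) ^ 2) P := by
    refine (hi.const_mul (K ^ 2)).mono' (hmeas.pow_const 2).aestronglyMeasurable ?_
    filter_upwards [hpt] with ω h
    rwa [Real.norm_of_nonneg (sq_nonneg _)]
  refine ⟨(memLp_two_iff_integrable_sq hmeas.aestronglyMeasurable).2 hsq, ?_⟩
  refine (integral_mono_ae hsq (hi.const_mul (K ^ 2)) hpt).trans ?_
  rw [integral_const_mul]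
  gcongr

theorem CondMeanLE.sq_of_rpow (hm : m ≤ mΩ) {x : Ω → ℝ} (hx : Measurable x) {ν C : ℝ} (hν : 0 ≤ ν)
    (h : CondMeanLE m P (fun ω => |x ω| ^ (2 + ν)) C) :
    CondMeanLE m P (fun ω => x ω ^ 2) (1 + C) := by
  have hsq := (integrable_sq_of_integrable_rpow hx.aestronglyMeasurable hν h.1).integrable_sq
  refine ⟨hsq, ?_⟩
  have h1 : P[fun ω => x ω ^ 2 | m] ≤ᵐ[P] P[(fun _ => (1 : ℝ)) + fun ω => |x ω| ^ (2 + ν) | m] :=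
    condExp_mono hsq ((integrable_const _).add h.1)
      (Eventually.of_forall fun ω => sq_le_one_add_abs_rpow hν _)
  have h2 := condExp_add (μ := P) (integrable_const (1 : ℝ)) h.1 m
  filter_upwards [h1, h2, h.2] with ω h1 h2 h3
  rw [h2, Pi.add_apply, condExp_const hm] at h1
  linarith

end WeightedMoments

/-! ### Regional averages of products -/

section UniformL2

variable {Ω : ℕ → Type*} [∀ S, MeasurableSpace (Ω S)] {P : ∀ S, Measure (Ω S)}
  {N : ℕ → ℕ} {f g : ∀ S, Fin (N S) → Ω S → ℝ}

/-- Square-integrable regional variables with uniformly bounded second moments. -/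
def UnifL2 (P : ∀ S, Measure (Ω S)) (f : ∀ S, Fin (N S) → Ω S → ℝ) : Prop :=
  ∃ C : ℝ, 0 ≤ C ∧ ∀ S i, MemLp (f S i) 2 (P S) ∧ ∫ ω, f S i ω ^ 2 ∂P S ≤ C

theorem UnifL2.add (hf : UnifL2 P f) (hg : UnifL2 P g) :
    UnifL2 P (fun S i ω => f S i ω + g S i ω) := by
  obtain ⟨C, hC0, hC⟩ := hf
  obtain ⟨C', hC0', hC'⟩ := hg
  refine ⟨2 * C + 2 * C', by positivity, fun S i => ⟨(hC S i).1.add (hC' S i).1, ?_⟩⟩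
  have h1 := (hC S i).1.integrable_sq
  have h2 := (hC' S i).1.integrable_sq
  have : ∫ ω, (f S i ω + g S i ω) ^ 2 ∂P S ≤ ∫ ω, 2 * f S i ω ^ 2 + 2 * g S i ω ^ 2 ∂P S := by
    refine integral_mono ((hC S i).1.add (hC' S i).1).integrable_sq
      ((h1.const_mul 2).add (h2.const_mul 2)) fun ω => ?_
    simp only
    nlinarith [sq_nonneg (f S i ω - g S i ω)]
  refine this.trans ?_
  rw [integral_add (h1.const_mul 2) (h2.const_mul 2), integral_const_mul, integral_const_mul]
  linarith [(hC S i).2, (hC' S i).2]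

theorem UnifL2.mul_const (hf : UnifL2 P f) (c : ℝ) : UnifL2 P (fun S i ω => f S i ω * c) := by
  obtain ⟨C, hC0, hC⟩ := hf
  refine ⟨C * c ^ 2, by positivity, fun S i => ⟨(hC S i).1.mul_const c, ?_⟩⟩
  simp_rw [mul_pow]
  rw [integral_mul_const]
  exact mul_le_mul_of_nonneg_right (hC S i).2 (sq_nonneg _)

theorem UnifL2.sub (hf : UnifL2 P f) (hg : UnifL2 P g) :
    UnifL2 P (fun S i ω => f S i ω - g S i ω) := by
  have := hf.add (hg.mul_const (-1))
  simpa [sub_eq_add_neg] using this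

theorem UnifL2.sum {ι : Type*} (T : Finset ι) {f : ι → ∀ S, Fin (N S) → Ω S → ℝ}
    (hf : ∀ k, UnifL2 P (f k)) : UnifL2 P (fun S i ω => ∑ k ∈ T, f k S i ω) := by
  classical
  induction T using Finset.induction_on with
  | empty => exact ⟨0, le_rfl, fun S i => by simp⟩
  | insert k T hk ih => simpa only [Finset.sum_insert hk] using (hf k).add ih

variable [∀ S, IsProbabilityMeasure (P S)]

theorem UnifL2.bddInProb_avg_mul (hf : UnifL2 P f) (hg : UnifL2 P g) :
    BddInProb P (fun S ω => (∑ i, f S i ω * g S i ω) / N S) := by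
  obtain ⟨C, hC0, hC⟩ := hf
  obtain ⟨C', hC0', hC'⟩ := hg
  have hi : ∀ S i, Integrable (fun ω => f S i ω * g S i ω) (P S) := fun S i =>
    (hC S i).1.integrable_mul (hC' S i).1
  have hi' : ∀ S i, Integrable (fun ω => |f S i ω * g S i ω|) (P S) := fun S i => (hi S i).abs
  refine BddInProb.of_integral_abs (C := √C * √C')
    (fun S => (integrable_finsetSum _ fun i _ => hi S i).div_const _) fun S => ?_
  have h1 : ∫ ω, |(∑ i, f S i ω * g S i ω) / N S| ∂P S ≤
      ∫ ω, (∑ i, |f S i ω * g S i ω|) / N S ∂P S := by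
    refine integral_mono ((integrable_finsetSum _ fun i _ => hi S i).div_const _).abs
      ((integrable_finsetSum _ fun i _ => hi' S i).div_const _) fun ω => ?_
    simp only
    rw [abs_div, Nat.abs_cast]
    gcongr
    exact Finset.abs_sum_le_sum_abs _ _
  refine h1.trans ?_
  rw [integral_div, integral_finsetSum _ fun i _ => hi' S i]
  refine div_le_of_le_mul₀ (Nat.cast_nonneg _) (by positivity) ?_
  calc ∑ i, ∫ ω, |f S i ω * g S i ω| ∂P S ≤ ∑ _i : Fin (N S), √C * √C' :=
        Finset.sum_le_sum fun i _ => (integral_abs_mul_le_sqrt (hC S i).1 (hC' S i).1).trans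
          (mul_le_mul (Real.sqrt_le_sqrt (hC S i).2) (Real.sqrt_le_sqrt (hC' S i).2)
            (Real.sqrt_nonneg _) (Real.sqrt_nonneg _))
    _ = √C * √C' * N S := by simp [mul_comm]

theorem UnifL2.bddInProb_avg_sq (hf : UnifL2 P f) :
    BddInProb P (fun S ω => (∑ i, f S i ω ^ 2) / N S) := by
  simpa only [sq] using hf.bddInProb_avg_mul hf

/-- Cauchy-Schwarz across regions: the squared average is at most a vanishing factor times a tight
one. -/
theorem UnifL2.convInProb_avg_mul_of_sq (hf : UnifL2 P f)
    (hg : ConvInProb P (fun S ω => (∑ i, g S i ω ^ 2) / N S) 0) :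
    ConvInProb P (fun S ω => (∑ i, f S i ω * g S i ω) / N S) 0 := by
  refine ConvInProb.of_sq ((hg.mul_bddInProb hf.bddInProb_avg_sq).of_abs_le fun S =>
    Eventually.of_forall fun ω => ?_)
  rw [abs_of_nonneg (sq_nonneg _)]
  refine le_trans ?_ (le_abs_self _)
  rw [div_pow, div_mul_div_comm, ← sq]
  gcongr
  rw [mul_comm]
  exact Finset.sum_mul_sq_le_sq_mul_sq _ _ _

/-- Small average L² norms do not make the average square small, so Cauchy-Schwarz is applied region
by region; this is where the bound on `f` must be uniform over regions. -/
theorem UnifL2.convInProb_avg_mul_of_sqrt (hf : UnifL2 P f) (hg : ∀ S i, MemLp (g S i) 2 (P S))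
    (h : Tendsto (fun S => (∑ i, √(∫ ω, g S i ω ^ 2 ∂P S)) / N S) atTop (𝓝 0)) :
    ConvInProb P (fun S ω => (∑ i, f S i ω * g S i ω) / N S) 0 := by
  obtain ⟨C, hC0, hC⟩ := hf
  have hi : ∀ S i, Integrable (fun ω => f S i ω * g S i ω) (P S) := fun S i =>
    (hC S i).1.integrable_mul (hg S i)
  have hi' : ∀ S i, Integrable (fun ω => |f S i ω * g S i ω|) (P S) := fun S i => (hi S i).abs
  refine ConvInProb.of_integral_abs
    (fun S => (integrable_finsetSum _ fun i _ => hi S i).div_const _)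
    (r := fun S => √C * ((∑ i, √(∫ ω, g S i ω ^ 2 ∂P S)) / N S)) (fun S => ?_)
    (by simpa using h.const_mul (√C))
  have h1 : ∫ ω, |(∑ i, f S i ω * g S i ω) / N S| ∂P S ≤
      ∫ ω, (∑ i, |f S i ω * g S i ω|) / N S ∂P S := by
    refine integral_mono ((integrable_finsetSum _ fun i _ => hi S i).div_const _).abs
      ((integrable_finsetSum _ fun i _ => hi' S i).div_const _) fun ω => ?_
    simp only
    rw [abs_div, Nat.abs_cast]
    gcongr
    exact Finset.abs_sum_le_sum_abs _ _
  refine h1.trans ?_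
  rw [integral_div, integral_finsetSum _ fun i _ => hi' S i, ← mul_div_assoc, Finset.mul_sum]
  gcongr with i
  exact (integral_abs_mul_le_sqrt (hC S i).1 (hg S i)).trans
    (mul_le_mul_of_nonneg_right (Real.sqrt_le_sqrt (hC S i).2) (Real.sqrt_nonneg _))

end UniformL2

/-! ### Measurability with respect to the conditioning fields, and the decomposition of the
regressor -/

namespace ShiftShare

section SigmaFields

variable {S N p : ℕ} {Ω : Type*} [mΩ : MeasurableSpace Ω] (D : ShiftShare S N p Ω)

theorem sigmaW_le : D.sigmaW ≤ mΩ :=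
  iSup₂_le fun i s => (D.measurable_w i s).comap_le

theorem F0_le : D.F0 ≤ mΩ := by
  refine sup_le (sup_le (sup_le (sup_le ?_ ?_) ?_) ?_) D.sigmaW_le
  · exact iSup₂_le fun s k => (D.measurable_ZZ s k).comap_le
  · exact iSup₂_le fun i k => (D.measurable_U i k).comap_le
  · exact iSup_le fun i => (D.measurable_Y0 i).comap_le
  · exact iSup₂_le fun i s => (D.measurable_B i s).comap_le

theorem measurable_w_sigmaW (i : Fin N) (s : Fin S) : Measurable[D.sigmaW] (D.w i s) :=
  (comap_measurable (D.w i s)).mono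
    (le_iSup₂_of_le (f := fun i s => MeasurableSpace.comap (D.w i s) inferInstance) i s le_rfl)
    le_rfl

theorem sigmaW_le_F0 : D.sigmaW ≤ D.F0 := le_sup_right

theorem measurable_w_F0 (i : Fin N) (s : Fin S) : Measurable[D.F0] (D.w i s) :=
  (D.measurable_w_sigmaW i s).mono D.sigmaW_le_F0 le_rfl

theorem measurable_B_F0 (i : Fin N) (s : Fin S) : Measurable[D.F0] (D.B i s) :=
  (comap_measurable (D.B i s)).mono
    ((le_iSup₂_of_le (f := fun i s => MeasurableSpace.comap (D.B i s) inferInstance)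
      i s le_rfl).trans (le_sup_of_le_left le_sup_right)) le_rfl

theorem measurable_Y0_F0 (i : Fin N) : Measurable[D.F0] (D.Y0 i) :=
  (comap_measurable (D.Y0 i)).mono
    ((le_iSup_of_le (f := fun i => MeasurableSpace.comap (D.Y0 i) inferInstance)
      i le_rfl).trans (le_sup_of_le_left (le_sup_of_le_left le_sup_right))) le_rfl

theorem measurable_U_F0 (i : Fin N) (k : Fin p) : Measurable[D.F0] (D.U i k) :=
  (comap_measurable (D.U i k)).mono
    ((le_iSup₂_of_le (f := fun i k => MeasurableSpace.comap (D.U i k) inferInstance)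
      i k le_rfl).trans (le_sup_of_le_left (le_sup_of_le_left (le_sup_of_le_left le_sup_right))))
    le_rfl

theorem measurable_ZZ_F0 (s : Fin S) (k : Fin p) : Measurable[D.F0] (D.ZZ s k) :=
  (comap_measurable (D.ZZ s k)).mono
    ((le_iSup₂_of_le (f := fun s k => MeasurableSpace.comap (D.ZZ s k) inferInstance)
      s k le_rfl).trans (le_sup_of_le_left (le_sup_of_le_left (le_sup_of_le_left le_sup_left))))
    le_rfl

end SigmaFields

section Decomposition

variable {S N p : ℕ} {Ω : Type*} [MeasurableSpace Ω] (D : ShiftShare S N p Ω) (γ : Fin p → ℝ)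

/-- The conditional mean of the shifter, linear in the sector-level controls. -/
def shifterMean (s : Fin S) (ω : Ω) : ℝ := ∑ k, D.ZZ s k ω * γ k

/-- The part of the shift-share regressor due to the demeaned shifters. -/
def exposure (i : Fin N) (ω : Ω) : ℝ := ∑ s, D.w i s ω * (D.XX s ω - D.shifterMean γ s ω)

/-- The measurement error in the linear combination of the controls that matters. -/
def controlError (i : Fin N) (ω : Ω) : ℝ := ∑ k, D.U i k ω * γ k

/-- The linear part `∑_s w_is X_s β_is` of the outcome. -/
def linearPart (i : Fin N) (ω : Ω) : ℝ := ∑ s, D.w i s ω * D.XX s ω * D.B i s ω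

theorem measurable_shifterMean_F0 (s : Fin S) : Measurable[D.F0] (D.shifterMean γ s) :=
  Finset.measurable_fun_sum (m := D.F0) _ fun k _ => (D.measurable_ZZ_F0 s k).mul_const _

/-- The conditional mean of the regressor is `∑_s w_is 𝒵_s'γ = Z_i'γ - U_i'γ`, so up to the error
`U_i'γ` it lies in the column space of the observed controls. -/
theorem X_eq (ω : Ω) :
    D.X ω = (fun i => D.exposure γ i ω - D.controlError γ i ω) + D.Z ω *ᵥ γ := by
  funext i
  have h : ∑ k, (∑ s, D.w i s ω * D.ZZ s k ω) * γ k =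
      ∑ s, D.w i s ω * ∑ k, D.ZZ s k ω * γ k := by
    simp_rw [Finset.sum_mul, Finset.mul_sum]
    rw [Finset.sum_comm]
    simp_rw [mul_assoc]
  simp only [X, exposure, controlError, shifterMean, Z, Pi.add_apply, Matrix.mulVec, dotProduct,
    Matrix.of_apply, add_mul, Finset.sum_add_distrib, h, mul_sub, Finset.sum_sub_distrib]
  ring

theorem Y_eq (ω : Ω) (i : Fin N) : D.Y ω i = D.Y0 i ω + D.linearPart i ω + D.L i ω := rfl

end Decomposition

end ShiftShare

/-! ### Algebra of least-squares residuals -/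

section Residuals

variable {N p : ℕ} {Z : Matrix (Fin N) (Fin p) ℝ}

theorem residual_add_mulVec (hZ : IsUnit (Zᵀ * Z).det) (v : Fin N → ℝ) (γ : Fin p → ℝ) :
    v + Z *ᵥ γ - Z *ᵥ ((Zᵀ * Z)⁻¹ *ᵥ (Zᵀ *ᵥ (v + Z *ᵥ γ))) =
      v - Z *ᵥ ((Zᵀ * Z)⁻¹ *ᵥ (Zᵀ *ᵥ v)) := by
  have h : (Zᵀ * Z)⁻¹ *ᵥ (Zᵀ *ᵥ (Z *ᵥ γ)) = γ := by
    rw [Matrix.mulVec_mulVec _ Zᵀ, Matrix.mulVec_mulVec, Matrix.nonsing_inv_mul _ hZ,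
      Matrix.one_mulVec]
  rw [Matrix.mulVec_add, Matrix.mulVec_add, h, Matrix.mulVec_add]
  abel

theorem residual_dotProduct (v y : Fin N → ℝ) :
    (v - Z *ᵥ ((Zᵀ * Z)⁻¹ *ᵥ (Zᵀ *ᵥ v))) ⬝ᵥ y =
      v ⬝ᵥ y - (Zᵀ *ᵥ v) ⬝ᵥ ((Zᵀ * Z)⁻¹ *ᵥ (Zᵀ *ᵥ y)) := by
  have hsymm : ((Zᵀ * Z)⁻¹)ᵀ = (Zᵀ * Z)⁻¹ := by
    rw [Matrix.transpose_nonsing_inv, Matrix.transpose_mul, Matrix.transpose_transpose]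
  have hadj : ∀ {m n : ℕ} (M : Matrix (Fin m) (Fin n) ℝ) (a : Fin n → ℝ) (b : Fin m → ℝ),
      (M *ᵥ a) ⬝ᵥ b = a ⬝ᵥ (Mᵀ *ᵥ b) := fun M a b => by
    rw [dotProduct_comm, Matrix.dotProduct_mulVec, ← Matrix.mulVec_transpose, dotProduct_comm]
  rw [sub_dotProduct, hadj Z, hadj (Zᵀ * Z)⁻¹, hsymm]

/-- The residual is orthogonal to the columns of `Z`, so one of its two copies may be replaced by
`v`. -/
theorem residual_dotProduct_self (hZ : IsUnit (Zᵀ * Z).det) (v : Fin N → ℝ) :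
    (v - Z *ᵥ ((Zᵀ * Z)⁻¹ *ᵥ (Zᵀ *ᵥ v))) ⬝ᵥ (v - Z *ᵥ ((Zᵀ * Z)⁻¹ *ᵥ (Zᵀ *ᵥ v))) =
      v ⬝ᵥ v - (Zᵀ *ᵥ v) ⬝ᵥ ((Zᵀ * Z)⁻¹ *ᵥ (Zᵀ *ᵥ v)) := by
  have h : Zᵀ *ᵥ (v - Z *ᵥ ((Zᵀ * Z)⁻¹ *ᵥ (Zᵀ *ᵥ v))) = 0 := by
    rw [Matrix.mulVec_sub, Matrix.mulVec_mulVec _ Zᵀ, Matrix.mulVec_mulVec _ (Zᵀ * Z),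
      Matrix.mul_nonsing_inv _ hZ, Matrix.one_mulVec, sub_self]
  rw [residual_dotProduct, h, Matrix.mulVec_zero, dotProduct_zero, sub_zero, dotProduct_comm,
    residual_dotProduct]

/-- Rescaling of the quadratic form in the inverse Gram matrix. -/
theorem dotProduct_inv_mulVec_div {A : Matrix (Fin p) (Fin p) ℝ} {n : ℝ} (hn : n ≠ 0)
    (g h : Fin p → ℝ) :
    (g ⬝ᵥ (A⁻¹ *ᵥ h)) / n =
      ∑ k, ∑ l, (g k / n) * ((Matrix.of fun k l => A k l / n)⁻¹ k l * (h l / n)) := by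
  have hA : (Matrix.of fun k l => A k l / n) = n⁻¹ • A := by
    ext k l
    simp [div_eq_inv_mul]
  have hinv : (n⁻¹ • A)⁻¹ = n • A⁻¹ := by
    -- For singular `A` both inverses are zero by convention, so the rescaling holds without
    -- invertibility.
    by_cases hdet : IsUnit A.det
    · have := Matrix.inv_smul' (A := A) (Units.mk0 n⁻¹ (inv_ne_zero hn)) hdet
      simpa [Units.smul_def] using this
    · have hdet' : ¬ IsUnit (n⁻¹ • A).det := by
        rw [isUnit_iff_ne_zero, not_not] at hdet ⊢
        rw [Matrix.det_smul, hdet, mul_zero]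
      rw [Matrix.nonsing_inv_apply_not_isUnit _ hdet, Matrix.nonsing_inv_apply_not_isUnit _ hdet',
        smul_zero]
  rw [hA, hinv]
  simp only [dotProduct, Matrix.mulVec, Finset.mul_sum, Finset.sum_div, Matrix.smul_apply,
    smul_eq_mul]
  refine Finset.sum_congr rfl fun k _ => Finset.sum_congr rfl fun l _ => ?_
  field_simp

end Residuals

/-! ### Asymptotics of averages against the exposure -/

section Exposure

variable {Ω : ℕ → Type*} [∀ S, MeasurableSpace (Ω S)] {P : ∀ S, Measure (Ω S)}
  [∀ S, IsProbabilityMeasure (P S)] {N : ℕ → ℕ} {p : ℕ} {γ : Fin p → ℝ}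
  {D : ∀ S, ShiftShare S (N S) p (Ω S)}

/-- Averages of the exposure against predetermined variables vanish. -/
theorem convInProb_exposure_mul
    (hw_nonneg : ∀ S i s, ∀ᵐ ω ∂P S, 0 ≤ (D S).w i s ω)
    (hw_sum : ∀ S i, ∀ᵐ ω ∂P S, ∑ s, (D S).w i s ω ≤ 1)
    (h_assign : ∀ S s, (P S)[(D S).XX s | (D S).F0] =ᵐ[P S] (D S).shifterMean γ s)
    (h_indep : ∀ S, CondIndepGiven (D S).F0 (P S) (D S).XX)
    (h_size : ConvInProb P (fun S ω => (⨆ s, (D S).n s ω) / N S) 0)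
    {ν C : ℝ} (hν : 0 ≤ ν)
    (h_XX : ∀ S s, CondMeanLE (D S).F0 (P S) (fun ω => |(D S).XX s ω| ^ (2 + ν)) C)
    {g : ∀ S, Fin (N S) → Ω S → ℝ} (hg : UnifL2 P g)
    (hgm : ∀ S i, Measurable[(D S).F0] (g S i)) :
    ConvInProb P (fun S ω => (∑ i, (D S).exposure γ i ω * g S i ω) / N S) 0 := by
  have hc : ConvInProb P
      (fun S ω => ∑ s, ((∑ i, (D S).w i s ω * g S i ω) / N S) ^ 2) 0 := by
    refine (h_size.mul_bddInProb hg.bddInProb_avg_sq).of_abs_le fun S => ?_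
    filter_upwards [ae_all_iff.2 fun i => ae_all_iff.2 fun s => hw_nonneg S i s,
      ae_all_iff.2 fun i => hw_sum S i] with ω h0 h1
    rw [abs_of_nonneg (Finset.sum_nonneg fun s _ => sq_nonneg _)]
    exact (sum_sq_share_avg_le h0 h1 fun i => g S i ω).trans (le_abs_self _)
  have heq : ∀ S ω, (∑ i, (D S).exposure γ i ω * g S i ω) / N S =
      ∑ s, ((∑ i, (D S).w i s ω * g S i ω) / N S) *
        ((D S).XX s ω - (D S).shifterMean γ s ω) := by
    intro S ω
    simp_rw [ShiftShare.exposure, Finset.sum_mul, div_mul_eq_mul_div, ← Finset.sum_div,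
      Finset.sum_mul]
    rw [Finset.sum_comm]
    congr 1
    exact Finset.sum_congr rfl fun s _ => Finset.sum_congr rfl fun i _ => by ring
  intro ε hε
  rw [ENNReal.tendsto_nhds_zero]
  intro η hη
  have hlim : Tendsto (fun δ : ℝ => ENNReal.ofReal (|centredBound ν C| * δ / ε ^ 2)) (𝓝[>] 0)
      (𝓝 0) := by
    have hcont : Continuous fun δ : ℝ => ENNReal.ofReal (|centredBound ν C| * δ / ε ^ 2) :=
      ENNReal.continuous_ofReal.comp (by fun_prop)
    have := hcont.tendsto 0
    simp only [mul_zero, zero_div, ENNReal.ofReal_zero] at this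
    exact this.mono_left nhdsWithin_le_nhds
  -- The threshold `δ` is fixed before `S`: it makes the Chebyshev term at most `η / 2`, and the
  -- event that the squared coefficients exceed `δ` uses the other half.
  obtain ⟨δ, hδ, hδ0⟩ :=
    ((hlim.eventually_le_const (ENNReal.half_pos hη.ne')).and self_mem_nhdsWithin).exists
  filter_upwards [(hc δ hδ0).eventually_le_const (ENNReal.half_pos hη.ne')] with S hS
  have hb := measure_abs_condLinear_ge_le (P := P S) (D S).F0_le (D S).measurable_XX (h_indep S) hν
    (h_XX S) (fun s => (D S).measurable_shifterMean_F0 γ s) (h_assign S)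
    (c := fun s ω => (∑ i, (D S).w i s ω * g S i ω) / N S)
    (fun s => Measurable.div_const (Finset.measurable_fun_sum (m := (D S).F0) _ fun i _ =>
      ((D S).measurable_w_F0 i s).mul (hgm S i)) _) (δ := δ) hε
  simp only [sub_zero, heq]
  refine hb.trans ?_
  rw [← ENNReal.add_halves η]
  refine add_le_add (le_trans (measure_mono fun ω hω => ?_) hS) hδ
  simp only [sub_zero, Set.mem_ofPred_eq] at hω ⊢
  exact le_trans hω (le_abs_self _)

/-- Averages of the exposure against weighted sums of the demeaned shifters converge to the
corresponding conditional second moments. -/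
theorem convInProb_exposure_quadratic
    (hw_nonneg : ∀ S i s, ∀ᵐ ω ∂P S, 0 ≤ (D S).w i s ω)
    (hw_sum : ∀ S i, ∀ᵐ ω ∂P S, ∑ s, (D S).w i s ω ≤ 1)
    (h_assign : ∀ S s, (P S)[(D S).XX s | (D S).F0] =ᵐ[P S] (D S).shifterMean γ s)
    (h_indep : ∀ S, CondIndepGiven (D S).F0 (P S) (D S).XX)
    (h_size : ConvInProb P (fun S ω => (⨆ s, (D S).n s ω) / N S) 0)
    {ν C : ℝ} (hν : 0 < ν)
    (h_XX : ∀ S s, CondMeanLE (D S).F0 (P S) (fun ω => |(D S).XX s ω| ^ (2 + ν)) C)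
    {b : ∀ S, Fin (N S) → Fin S → Ω S → ℝ} (hbm : ∀ S i s, Measurable[(D S).F0] (b S i s))
    {K : ℝ} (hK : 0 ≤ K) (hb : ∀ S i s, ∀ᵐ ω ∂P S, |b S i s ω| ≤ K) :
    ConvInProb P (fun S ω =>
      (∑ i, (D S).exposure γ i ω *
        ∑ s, (D S).w i s ω * ((D S).XX s ω - (D S).shifterMean γ s ω) * b S i s ω) / N S -
      (∑ i, ∑ s, (D S).w i s ω ^ 2 * (D S).condVariance (P S) s ω * b S i s ω) / N S) 0 := by
  have hM : ConvInProb P (fun S ω =>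
      ∑ t, ∑ s, ((∑ i, (D S).w i t ω * (D S).w i s ω * b S i s ω) / N S) ^ 2) 0 := by
    have h0 := h_size.const_mul (K ^ 2)
    rw [mul_zero] at h0
    refine h0.of_abs_le fun S => ?_
    filter_upwards [ae_all_iff.2 fun i => ae_all_iff.2 fun s => hw_nonneg S i s,
      ae_all_iff.2 fun i => hw_sum S i,
      ae_all_iff.2 fun i => ae_all_iff.2 fun s => hb S i s] with ω h0 h1 h2
    rw [abs_of_nonneg (Finset.sum_nonneg fun t _ => Finset.sum_nonneg fun s _ => sq_nonneg _)]
    exact (sum_sum_sq_share_mul_le h0 h1 h2).trans (le_abs_self _)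
  have heq : ∀ S ω, (∑ i, (D S).exposure γ i ω *
        ∑ s, (D S).w i s ω * ((D S).XX s ω - (D S).shifterMean γ s ω) * b S i s ω) / N S -
      (∑ i, ∑ s, (D S).w i s ω ^ 2 * (D S).condVariance (P S) s ω * b S i s ω) / N S =
      ∑ t, ∑ s, ((∑ i, (D S).w i t ω * (D S).w i s ω * b S i s ω) / N S) *
        (((D S).XX t ω - (D S).shifterMean γ t ω) * ((D S).XX s ω - (D S).shifterMean γ s ω)) -
      ∑ s, ((∑ i, (D S).w i s ω * (D S).w i s ω * b S i s ω) / N S) *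
        Var[(D S).XX s; P S | (D S).F0] ω := by
    intro S ω
    congr 1
    · simp_rw [ShiftShare.exposure, Finset.sum_mul_sum, div_mul_eq_mul_div, ← Finset.sum_div,
        Finset.sum_mul]
      rw [Finset.sum_comm]
      congr 1
      refine Finset.sum_congr rfl fun t _ => ?_
      rw [Finset.sum_comm]
      exact Finset.sum_congr rfl fun s _ => Finset.sum_congr rfl fun i _ => by ring
    · simp_rw [div_mul_eq_mul_div, ← Finset.sum_div, Finset.sum_mul]
      rw [Finset.sum_comm]
      congr 1
      refine Finset.sum_congr rfl fun s _ => Finset.sum_congr rfl fun i _ => ?_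
      rw [ShiftShare.condVariance]
      ring
  intro ε hε
  rw [ENNReal.tendsto_nhds_zero]
  intro η hη
  have hη2 : 0 < η / 2 := ENNReal.half_pos hη.ne'
  have hη4 : 0 < η / 2 / 2 := ENNReal.half_pos hη2.ne'
  have hlimR : Tendsto (fun R : ℝ => ENNReal.ofReal
      (2 * (|centredBound ν C| / R ^ ν) * K / (ε / 3 / 2))) atTop (𝓝 0) := by
    have h1 : Tendsto (fun R : ℝ => |centredBound ν C| / R ^ ν) atTop (𝓝 0) :=
      tendsto_const_nhds.div_atTop (tendsto_rpow_atTop hν)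
    have h2 := ENNReal.tendsto_ofReal (((h1.const_mul 2).mul_const K).div_const (ε / 3 / 2))
    simpa using h2
  -- The order matters: `R` is chosen first to make the truncation remainder small, then `δ`
  -- depending on `R` to absorb the factor `R ^ 4`. The budget is `η / 4` for each, plus `η / 2` for
  -- the event of large coefficients.
  obtain ⟨R, hR, hR0⟩ := ((hlimR.eventually_le_const hη4).and (eventually_gt_atTop 0)).exists
  have hlim : Tendsto (fun δ : ℝ =>
      ENNReal.ofReal (|centredBound ν C| ^ 2 * δ / (ε / 3) ^ 2) +
      ENNReal.ofReal (|centredBound ν C| ^ 2 * δ / (ε / 3) ^ 2) +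
      ENNReal.ofReal (R ^ 4 * δ / (ε / 3 / 2) ^ 2)) (𝓝[>] 0) (𝓝 0) := by
    have hcont : Continuous fun δ : ℝ =>
      ENNReal.ofReal (|centredBound ν C| ^ 2 * δ / (ε / 3) ^ 2) +
      ENNReal.ofReal (|centredBound ν C| ^ 2 * δ / (ε / 3) ^ 2) +
      ENNReal.ofReal (R ^ 4 * δ / (ε / 3 / 2) ^ 2) :=
      ((ENNReal.continuous_ofReal.comp (by fun_prop)).add
        (ENNReal.continuous_ofReal.comp (by fun_prop))).add
        (ENNReal.continuous_ofReal.comp (by fun_prop))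
    have := hcont.tendsto 0
    simp only [mul_zero, zero_div, ENNReal.ofReal_zero, add_zero] at this
    exact this.mono_left nhdsWithin_le_nhds
  obtain ⟨δ, hδ, hδ0⟩ := ((hlim.eventually_le_const hη4).and self_mem_nhdsWithin).exists
  filter_upwards [(hM δ hδ0).eventually_le_const hη2] with S hS
  have hMA : ∀ᵐ ω ∂P S, ∑ s, |(∑ i, (D S).w i s ω * (D S).w i s ω * b S i s ω) / N S| ≤ K := by
    filter_upwards [ae_all_iff.2 fun i => ae_all_iff.2 fun s => hw_nonneg S i s,
      ae_all_iff.2 fun i => hw_sum S i,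
      ae_all_iff.2 fun i => ae_all_iff.2 fun s => hb S i s] with ω h0 h1 h2
    exact sum_abs_share_sq_le h0 h1 hK h2
  have hbd := measure_abs_condQuadratic_ge_le (P := P S) (D S).F0_le (D S).measurable_XX (h_indep S)
    hν.le (h_XX S) (fun s => (D S).measurable_shifterMean_F0 γ s) (h_assign S)
    (M := fun t s ω => (∑ i, (D S).w i t ω * (D S).w i s ω * b S i s ω) / N S)
    (fun t s => Measurable.div_const (Finset.measurable_fun_sum (m := (D S).F0) _ fun i _ =>
      (((D S).measurable_w_F0 i t).mul ((D S).measurable_w_F0 i s)).mul (hbm S i s)) _)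
    hMA (δ := δ) hε hR0
  simp only [sub_zero, heq]
  refine hbd.trans ?_
  rw [← add_assoc (_ + _) (ENNReal.ofReal (R ^ 4 * δ / (ε / 3 / 2) ^ 2))]
  have h1 : P S {ω | δ ≤ ∑ t, ∑ s,
      ((∑ i, (D S).w i t ω * (D S).w i s ω * b S i s ω) / N S) ^ 2} ≤ η / 2 := by
    refine le_trans (measure_mono fun ω hω => ?_) hS
    simp only [sub_zero, Set.mem_ofPred_eq] at hω ⊢
    exact le_trans hω (le_abs_self _)
  exact (add_le_add h1 ((add_le_add hδ hR).trans_eq (ENNReal.add_halves _))).trans_eq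
    (ENNReal.add_halves _)

end Exposure

/-! ### Negligible projection terms and ratios -/

section Projection

variable {Ω : ℕ → Type*} [∀ S, MeasurableSpace (Ω S)] {P : ∀ S, Measure (Ω S)}
  {N : ℕ → ℕ} {p : ℕ} {Z : ∀ S, Ω S → Matrix (Fin (N S)) (Fin p) ℝ}
  {Q : Matrix (Fin p) (Fin p) ℝ}

/-- After scaling, the form is a sum of `p²` products, with `p` fixed, of a vanishing factor, a
convergent entry of the inverse Gram matrix and a tight factor. -/
theorem convInProb_projection (hN : ∀ᶠ S in atTop, N S ≠ 0) (hQ : Q.PosDef)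
    (hZ : ∀ k l, ConvInProb P (fun S ω => ((Z S ω)ᵀ * Z S ω) k l / N S) (Q k l))
    {g h : ∀ S, Ω S → Fin p → ℝ} (hg : ∀ k, ConvInProb P (fun S ω => g S ω k / N S) 0)
    (hh : ∀ k, BddInProb P (fun S ω => h S ω k / N S)) :
    ConvInProb P (fun S ω => (g S ω ⬝ᵥ (((Z S ω)ᵀ * Z S ω)⁻¹ *ᵥ h S ω)) / N S) 0 := by
  have hinv : ∀ k l, ConvInProb P (fun S ω =>
      (Matrix.of fun k l => ((Z S ω)ᵀ * Z S ω) k l / (N S : ℝ))⁻¹ k l) (Q⁻¹ k l) := fun k l =>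
    ConvInProb.comp_matrix (A := fun S ω =>
      Matrix.of fun k l => ((Z S ω)ᵀ * Z S ω) k l / (N S : ℝ)) (fun k l => hZ k l)
      (f := fun M => M⁻¹ k l) (Matrix.continuousAt_inv_apply hQ.det_pos.ne' k l)
  have hsum : ConvInProb P (fun S ω => ∑ k, ∑ l, (g S ω k / N S) *
      ((Matrix.of fun k l => ((Z S ω)ᵀ * Z S ω) k l / (N S : ℝ))⁻¹ k l * (h S ω l / N S))) 0 := by
    refine ConvInProb.sum_zero fun k => ConvInProb.sum_zero fun l => ?_
    refine (((hg k).mul_bddInProb (hinv k l).bddInProb).mul_bddInProb (hh l)).congr fun S ω => ?_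
    ring
  refine hsum.congr_ae ?_
  filter_upwards [hN] with S hS
  refine Eventually.of_forall fun ω => ?_
  exact (dotProduct_inv_mulVec_div (Nat.cast_ne_zero.2 hS) _ _).symm

theorem tendsto_measure_not_isUnit_det (hQ : Q.PosDef)
    (hZ : ∀ k l, ConvInProb P (fun S ω => ((Z S ω)ᵀ * Z S ω) k l / N S) (Q k l)) :
    Tendsto (fun S => P S {ω | ¬ IsUnit ((Z S ω)ᵀ * Z S ω).det}) atTop (𝓝 0) := by
  have hdet : ConvInProb P (fun S ω =>
      (Matrix.of fun k l => ((Z S ω)ᵀ * Z S ω) k l / (N S : ℝ)).det) Q.det :=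
    ConvInProb.comp_matrix (A := fun S ω =>
      Matrix.of fun k l => ((Z S ω)ᵀ * Z S ω) k l / (N S : ℝ)) (fun k l => hZ k l)
      (f := Matrix.det) (continuous_id.matrix_det.continuousAt)
  refine tendsto_of_tendsto_of_tendsto_of_le_of_le tendsto_const_nhds
    (hdet.tendsto_measure_not_pos hQ.det_pos) (fun S => zero_le) fun S => measure_mono ?_
  intro ω hω
  simp only [Set.mem_ofPred_eq, isUnit_iff_ne_zero, not_not] at hω ⊢
  have hA : (Matrix.of fun k l => ((Z S ω)ᵀ * Z S ω) k l / (N S : ℝ)) =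
      (N S : ℝ)⁻¹ • ((Z S ω)ᵀ * Z S ω) := by
    ext k l
    simp [div_eq_inv_mul]
  rw [hA, Matrix.det_smul, hω, mul_zero]
  exact lt_irrefl _

/-- The difference equals `(A - A') / B + A' (1 / B - 1 / B')`. The numerators need not converge;
closeness and tightness of `A'` suffice. -/
theorem ConvInProb.div_sub_div {A A' B B' : ∀ S, Ω S → ℝ} {c : ℝ} (hc : c ≠ 0)
    (hA : ConvInProb P (fun S ω => A S ω - A' S ω) 0) (hA' : BddInProb P A')
    (hB : ConvInProb P B c) (hB' : ConvInProb P B' c) :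
    ConvInProb P (fun S ω => A S ω / B S ω - A' S ω / B' S ω) 0 := by
  have h1 := hA.mul_bddInProb (hB.inv hc).bddInProb
  have h2 := (hB.inv hc).sub (hB'.inv hc)
  rw [sub_self] at h2
  have h3 := h1.add (h2.mul_bddInProb hA')
  rw [add_zero] at h3
  exact h3.congr fun S ω => by simp only [div_eq_mul_inv]; ring

end Projection

/-! ### The consistency theorem -/

theorem proposition3
    {Ω : ℕ → Type*} [∀ S, MeasurableSpace (Ω S)]
    (P : ∀ S, Measure (Ω S)) [∀ S, IsProbabilityMeasure (P S)]
    (N : ℕ → ℕ) (p : ℕ) (γ : Fin p → ℝ)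
    (D : ∀ S, ShiftShare S (N S) p (Ω S))
    -- shares
    (hw_nonneg : ∀ S i s, ∀ᵐ ω ∂P S, 0 ≤ (D S).w i s ω)
    (hw_sum : ∀ S i, ∀ᵐ ω ∂P S, ∑ s, (D S).w i s ω ≤ 1)
    -- shifters as good as randomly assigned given the sector-level controls, and independent
    (h_assign : ∀ S s, (P S)[(D S).XX s | (D S).F0] =ᵐ[P S]
      fun ω => ∑ k, (D S).ZZ s k ω * γ k)
    (h_indep : ∀ S, CondIndepGiven (D S).F0 (P S) (D S).XX)
    -- no sector dominates
    (h_size : ConvInProb P (fun S ω => (⨆ s, (D S).n s ω) / N S) 0)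
    -- the measurement error in the controls that matter vanishes on average
    (h_Uγ : Tendsto (fun S => (∑ i, ∫ ω, (∑ k, (D S).U i k ω * γ k) ^ 2 ∂P S) / N S)
      atTop (𝓝 0))
    -- bounded treatment effects
    (h_beta : ∃ C : ℝ, ∀ S i s, ∀ᵐ ω ∂P S, |(D S).B i s ω| ≤ C)
    -- the shifters have sufficient variation
    (h_var : ∃ c : ℝ, 0 < c ∧ ConvInProb P (fun S ω => (D S).totalWeight (P S) ω / N S) c)
    -- moments of the shifters, of `Y(0)`, of `U` and of the sector-level controls
    (h_XX : ∃ ν C : ℝ, 0 < ν ∧ ∀ S s,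
      CondMeanLE (D S).F0 (P S) (fun ω => |(D S).XX s ω| ^ (2 + ν)) C)
    (h_Y0 : ∃ C : ℝ, ∀ S i, CondMeanLE (D S).sigmaW (P S) (fun ω => (D S).Y0 i ω ^ 2) C)
    (h_U : ∃ C : ℝ, ∀ S i k, CondMeanLE (D S).sigmaW (P S) (fun ω => (D S).U i k ω ^ 2) C)
    (h_ZZ : ∃ C : ℝ, ∀ S s k, CondMeanLE (D S).sigmaW (P S) (fun ω => (D S).ZZ s k ω ^ 2) C)
    -- the linearization error vanishes on average
    (h_L_int : ∀ S i, Integrable (fun ω => (D S).L i ω ^ 2) (P S))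
    (h_L : Tendsto (fun S => (∑ i, √(∫ ω, (D S).L i ω ^ 2 ∂P S)) / N S) atTop (𝓝 0))
    -- the controls are not collinear
    (h_ZtZ : ∃ Q : Matrix (Fin p) (Fin p) ℝ, Q.PosDef ∧ ∀ k l,
      ConvInProb P (fun S ω => (((D S).Z ω)ᵀ * (D S).Z ω) k l / N S) (Q k l)) :
    -- the estimator and the estimand are well defined with probability approaching one
    Tendsto (fun S => P S {ω | ¬ (IsUnit (((D S).Z ω)ᵀ * (D S).Z ω).det ∧
      0 < (D S).Xres ω ⬝ᵥ (D S).Xres ω ∧ 0 < (D S).totalWeight (P S) ω)}) atTop (𝓝 0) ∧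
    -- consistency
    ConvInProb P (fun S ω => (D S).betaHat ω - (D S).betaBar (P S) ω) 0 ∧
    -- homogeneous effects
    (∀ b : ℕ → ℝ, (∀ S i s, ∀ᵐ ω ∂P S, (D S).B i s ω = b S) →
      Tendsto (fun S => P S {ω | (D S).betaBar (P S) ω ≠ b S}) atTop (𝓝 0) ∧
      ConvInProb P (fun S ω => (D S).betaHat ω - b S) 0) := by
  obtain ⟨CB, hCB⟩ := h_beta
  obtain ⟨c, hc, hW⟩ := h_var
  obtain ⟨ν, CX, hν, hXX⟩ := h_XX
  obtain ⟨CY, hCY⟩ := h_Y0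
  obtain ⟨CU, hCU⟩ := h_U
  obtain ⟨CZ, hCZ⟩ := h_ZZ
  obtain ⟨Q, hQ, hZ⟩ := h_ZtZ
  have hB : ∀ S i s, ∀ᵐ ω ∂P S, |(D S).B i s ω| ≤ |CB| := fun S i s => by
    filter_upwards [hCB S i s] with ω h using h.trans (le_abs_self _)
  have hw0 : ∀ S i, ∀ᵐ ω ∂P S, ∀ s, 0 ≤ (D S).w i s ω := fun S i =>
    ae_all_iff.2 fun s => hw_nonneg S i s
  -- If `N S = 0`, the normalized total weight is `0` by the convention for division, at distance
  -- `c` from its limit with probability one; this cannot happen for large `S`.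
  have hN : ∀ᶠ S in atTop, N S ≠ 0 := by
    filter_upwards [(hW c hc).eventually_lt_const (zero_lt_one : (0 : ENNReal) < 1)] with S hS h0
    refine absurd hS (not_lt.2 (le_of_eq ?_))
    have : {ω | c ≤ |(D S).totalWeight (P S) ω / N S - c|} = Set.univ := by
      ext ω
      simp [h0, abs_of_pos hc]
    rw [this, measure_univ]
  -- second moments
  have uY0 : UnifL2 P (fun S i => (D S).Y0 i) := by
    refine ⟨|CY|, abs_nonneg _, fun S i => ⟨?_, ?_⟩⟩
    · exact (memLp_two_iff_integrable_sq
        ((D S).measurable_Y0 i).aestronglyMeasurable).2 (hCY S i).1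
    · exact ((hCY S i).integral_le (D S).sigmaW_le).trans (le_abs_self _)
  have uU : ∀ k, UnifL2 P (fun S i => (D S).U i k) := by
    refine fun k => ⟨|CU|, abs_nonneg _, fun S i => ⟨?_, ?_⟩⟩
    · exact (memLp_two_iff_integrable_sq
        ((D S).measurable_U i k).aestronglyMeasurable).2 (hCU S i k).1
    · exact ((hCU S i k).integral_le (D S).sigmaW_le).trans (le_abs_self _)
  have uX : ∀ (K : ℝ) (b : ∀ S, Fin (N S) → Fin S → Ω S → ℝ), (∀ S i s, Measurable (b S i s)) →
      (∀ S i s, ∀ᵐ ω ∂P S, |b S i s ω| ≤ K) →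
      UnifL2 P (fun S i ω => ∑ s, (D S).w i s ω * (D S).XX s ω * b S i s ω) :=
    fun K b hbm hb => ⟨K ^ 2 * |1 + CX|, by positivity, fun S i => memLp_weighted_sum (D S).F0_le
      (fun s => (D S).measurable_w_F0 i s) (hw0 S i) (hw_sum S i) (D S).measurable_XX (hbm S i)
      (ae_all_iff.2 fun s => hb S i s)
      fun s => (hXX S s).sq_of_rpow (D S).F0_le ((D S).measurable_XX s) hν.le⟩
  -- The moments of the sector-level controls are bounded given `W` only. This is enough even for
  -- `b` not determined by `W`, since `b` is bounded out pointwise before conditioning.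
  have uZ : ∀ (K : ℝ) (b : ∀ S, Fin (N S) → Fin S → Ω S → ℝ), (∀ S i s, Measurable (b S i s)) →
      (∀ S i s, ∀ᵐ ω ∂P S, |b S i s ω| ≤ K) → ∀ k,
      UnifL2 P (fun S i ω => ∑ s, (D S).w i s ω * (D S).ZZ s k ω * b S i s ω) :=
    fun K b hbm hb k => ⟨K ^ 2 * |CZ|, by positivity, fun S i => memLp_weighted_sum (D S).sigmaW_le
      (fun s => (D S).measurable_w_sigmaW i s) (hw0 S i) (hw_sum S i)
      (fun s => (D S).measurable_ZZ s k) (hbm S i) (ae_all_iff.2 fun s => hb S i s)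
      fun s => hCZ S s k⟩
  have uX1 : UnifL2 P (fun S i ω => ∑ s, (D S).w i s ω * (D S).XX s ω) := by
    simpa using uX 1 (fun _ _ _ _ => 1) (fun _ _ _ => measurable_const) (by simp)
  have uZ1 : ∀ k, UnifL2 P (fun S i ω => ∑ s, (D S).w i s ω * (D S).ZZ s k ω) := by
    simpa using uZ 1 (fun _ _ _ _ => 1) (fun _ _ _ => measurable_const) (by simp)
  have uLin : UnifL2 P (fun S i => (D S).linearPart i) :=
    uX |CB| (fun S => (D S).B) (fun S => (D S).measurable_B) hB
  have hswap : ∀ S i ω (b : Fin S → ℝ), ∑ k, (∑ s, (D S).w i s ω * (D S).ZZ s k ω * b s) * γ k =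
      ∑ s, (D S).w i s ω * (D S).shifterMean γ s ω * b s := by
    intro S i ω b
    simp_rw [ShiftShare.shifterMean, Finset.sum_mul, Finset.mul_sum, Finset.sum_mul]
    rw [Finset.sum_comm]
    exact Finset.sum_congr rfl fun s _ => Finset.sum_congr rfl fun k _ => by ring
  have uMean : UnifL2 P (fun S i ω =>
      ∑ s, (D S).w i s ω * (D S).shifterMean γ s ω * (D S).B i s ω) := by
    have := UnifL2.sum Finset.univ fun k => (uZ |CB| (fun S => (D S).B)
      (fun S => (D S).measurable_B) hB k).mul_const (γ k)
    simpa only [hswap] using this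
  have uA : UnifL2 P (fun S i => (D S).exposure γ i) := by
    have h1 := UnifL2.sum Finset.univ fun k => (uZ1 k).mul_const (γ k)
    have h2 := uX1.sub h1
    have heq : ∀ S i ω, (D S).exposure γ i ω = ∑ s, (D S).w i s ω * (D S).XX s ω -
        ∑ k, (∑ s, (D S).w i s ω * (D S).ZZ s k ω) * γ k := by
      intro S i ω
      have := hswap S i ω fun _ => 1
      simp only [mul_one] at this
      rw [this]
      simp [ShiftShare.exposure, mul_sub]
    have heq' : (fun S i => (D S).exposure γ i) = fun S i ω =>
        ∑ s, (D S).w i s ω * (D S).XX s ω -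
        ∑ k, (∑ s, (D S).w i s ω * (D S).ZZ s k ω) * γ k := by
      funext S i ω; exact heq S i ω
    rw [heq']
    exact h2
  have uE : UnifL2 P (fun S i => (D S).controlError γ i) :=
    UnifL2.sum Finset.univ fun k => (uU k).mul_const (γ k)
  have uZk : ∀ k, UnifL2 P (fun S i ω => (D S).Z ω i k) := fun k => (uZ1 k).add (uU k)
  have hL2 : ∀ S i, MemLp ((D S).L i) 2 (P S) := fun S i =>
    (memLp_two_iff_integrable_sq ((D S).measurable_Lfun i).aestronglyMeasurable).2 (h_L_int S i)
  have mZk : ∀ S i k, Measurable[(D S).F0] (fun ω => (D S).Z ω i k) := fun S i k =>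
    Measurable.add (Finset.measurable_fun_sum (m := (D S).F0) _ fun s _ =>
      ((D S).measurable_w_F0 i s).mul ((D S).measurable_ZZ_F0 s k)) ((D S).measurable_U_F0 i k)
  -- negligible averages
  have hEsq : ConvInProb P (fun S ω => (∑ i, (D S).controlError γ i ω ^ 2) / N S) 0 := by
    obtain ⟨_, _, hE⟩ := uE
    have hi : ∀ S i, Integrable (fun ω => (D S).controlError γ i ω ^ 2) (P S) := fun S i =>
      (hE S i).1.integrable_sq
    refine ConvInProb.of_integral_abs
      (fun S => (integrable_finsetSum _ fun i _ => hi S i).div_const _) (fun S => ?_) h_Uγ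
    have habs : ∀ ω, |(∑ i, (D S).controlError γ i ω ^ 2) / (N S : ℝ)| =
        (∑ i, (D S).controlError γ i ω ^ 2) / N S := fun ω =>
      abs_of_nonneg (div_nonneg (Finset.sum_nonneg fun i _ => sq_nonneg _) (Nat.cast_nonneg _))
    simp_rw [habs]
    rw [integral_div, integral_finsetSum _ fun i _ => hi S i]
    exact le_rfl
  have hAmul : ∀ {g : ∀ S, Fin (N S) → Ω S → ℝ}, UnifL2 P g →
      (∀ S i, Measurable[(D S).F0] (g S i)) →
      ConvInProb P (fun S ω => (∑ i, (D S).exposure γ i ω * g S i ω) / N S) 0 := fun hg hgm =>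
    convInProb_exposure_mul hw_nonneg hw_sum h_assign h_indep h_size hν.le hXX hg hgm
  have hEmul : ∀ {g : ∀ S, Fin (N S) → Ω S → ℝ}, UnifL2 P g →
      ConvInProb P (fun S ω => (∑ i, g S i ω * (D S).controlError γ i ω) / N S) 0 := fun hg =>
    hg.convInProb_avg_mul_of_sq hEsq
  have hLmul : ∀ {g : ∀ S, Fin (N S) → Ω S → ℝ}, UnifL2 P g →
      ConvInProb P (fun S ω => (∑ i, g S i ω * (D S).L i ω) / N S) 0 := fun hg =>
    hg.convInProb_avg_mul_of_sqrt hL2 h_L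
  -- the numerator and the denominator before partialling out the controls
  have hAA : ConvInProb P (fun S ω => (∑ i, (D S).exposure γ i ω * (D S).exposure γ i ω) / N S -
      (D S).totalWeight (P S) ω / N S) 0 := by
    have := convInProb_exposure_quadratic hw_nonneg hw_sum h_assign h_indep h_size hν hXX
      (b := fun _ _ _ _ => 1) (fun _ _ _ => measurable_const) zero_le_one (by simp)
    exact this.congr fun S ω => by simp only [mul_one]; rfl
  let v : ∀ S, Ω S → Fin (N S) → ℝ := fun S ω i =>
    (D S).exposure γ i ω - (D S).controlError γ i ω
  let R : ∀ S, Ω S → ℝ := fun S ω =>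
    ∑ i, ∑ s, (D S).w i s ω ^ 2 * (D S).condVariance (P S) s ω * (D S).B i s ω
  -- Expanding `(A - E)'(A - E)`, only `A'A` survives, and it tracks the total weight.
  have hvv : ConvInProb P (fun S ω => (v S ω ⬝ᵥ v S ω) / N S) c := by
    have h := ((hAA.add hW).sub ((hEmul uA).const_mul 2)).add hEsq
    simp only [mul_zero, sub_zero, add_zero, zero_add] at h
    refine h.congr fun S ω => ?_
    have : v S ω ⬝ᵥ v S ω = ∑ i, (D S).exposure γ i ω * (D S).exposure γ i ω -
        2 * ∑ i, (D S).exposure γ i ω * (D S).controlError γ i ω +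
        ∑ i, (D S).controlError γ i ω ^ 2 := by
      simp only [v, dotProduct, Finset.mul_sum]
      rw [← Finset.sum_sub_distrib, ← Finset.sum_add_distrib]
      exact Finset.sum_congr rfl fun i _ => by ring
    rw [this]
    ring
  -- The shifters in the linear part are split into deviation and conditional mean. The deviation
  -- gives the quadratic form centred at `R`; the mean part is `F0`-measurable, so its average
  -- against the exposure vanishes.
  have hAlin : ConvInProb P (fun S ω =>
      (∑ i, (D S).exposure γ i ω * (D S).linearPart i ω) / N S - R S ω / N S) 0 := by
    have h1 := convInProb_exposure_quadratic hw_nonneg hw_sum h_assign h_indep h_size hν hXX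
      (fun S => (D S).measurable_B_F0) (abs_nonneg CB) hB
    have h2 := hAmul uMean fun S i => Finset.measurable_fun_sum (m := (D S).F0) _ fun s _ =>
      (((D S).measurable_w_F0 i s).mul ((D S).measurable_shifterMean_F0 γ s)).mul
        ((D S).measurable_B_F0 i s)
    have h3 := h1.add h2
    rw [add_zero] at h3
    refine h3.congr fun S ω => ?_
    have : ∑ i, (D S).exposure γ i ω * (D S).linearPart i ω =
        ∑ i, (D S).exposure γ i ω *
          (∑ s, (D S).w i s ω * ((D S).XX s ω - (D S).shifterMean γ s ω) * (D S).B i s ω) +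
        ∑ i, (D S).exposure γ i ω *
          ∑ s, (D S).w i s ω * (D S).shifterMean γ s ω * (D S).B i s ω := by
      rw [← Finset.sum_add_distrib]
      refine Finset.sum_congr rfl fun i _ => ?_
      rw [← mul_add, ← Finset.sum_add_distrib]
      congr 1
      exact Finset.sum_congr rfl fun s _ => by ring
    rw [this]
    ring
  have hvY : ConvInProb P (fun S ω => (v S ω ⬝ᵥ (D S).Y ω) / N S - R S ω / N S) 0 := by
    have h := ((((hAmul uY0 fun S i => (D S).measurable_Y0_F0 i).add hAlin).add (hLmul uA)).sub
      (hEmul uY0)).sub (hEmul uLin) |>.sub (hLmul uE)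
    simp only [sub_zero, add_zero] at h
    refine h.congr fun S ω => ?_
    have : v S ω ⬝ᵥ (D S).Y ω = ∑ i, (D S).exposure γ i ω * (D S).Y0 i ω +
        ∑ i, (D S).exposure γ i ω * (D S).linearPart i ω +
        ∑ i, (D S).exposure γ i ω * (D S).L i ω -
        ∑ i, (D S).Y0 i ω * (D S).controlError γ i ω -
        ∑ i, (D S).linearPart i ω * (D S).controlError γ i ω -
        ∑ i, (D S).controlError γ i ω * (D S).L i ω := by
      simp only [v, dotProduct, ShiftShare.Y_eq]
      simp only [← Finset.sum_sub_distrib, ← Finset.sum_add_distrib]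
      exact Finset.sum_congr rfl fun i _ => by ring
    rw [this]
    ring
  -- the controls
  have hZv : ∀ k, ConvInProb P (fun S ω => (((D S).Z ω)ᵀ *ᵥ v S ω) k / N S) 0 := by
    intro k
    have h := (hAmul (uZk k) fun S i => mZk S i k).sub (hEmul (uZk k))
    rw [sub_zero] at h
    refine h.congr fun S ω => ?_
    have : (((D S).Z ω)ᵀ *ᵥ v S ω) k = ∑ i, (D S).exposure γ i ω * (D S).Z ω i k -
        ∑ i, (D S).Z ω i k * (D S).controlError γ i ω := by
      simp only [v, Matrix.mulVec, dotProduct, Matrix.transpose_apply]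
      rw [← Finset.sum_sub_distrib]
      exact Finset.sum_congr rfl fun i _ => by ring
    rw [this]
    ring
  have hZY : ∀ k, BddInProb P (fun S ω => (((D S).Z ω)ᵀ *ᵥ (D S).Y ω) k / N S) := by
    intro k
    have h := (((uZk k).bddInProb_avg_mul uY0).add ((uZk k).bddInProb_avg_mul uLin)).add
      (hLmul (uZk k)).bddInProb
    refine h.of_abs_le fun S => Eventually.of_forall fun ω => le_of_eq (congrArg abs ?_)
    have : (((D S).Z ω)ᵀ *ᵥ (D S).Y ω) k = ∑ i, (D S).Z ω i k * (D S).Y0 i ω +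
        ∑ i, (D S).Z ω i k * (D S).linearPart i ω + ∑ i, (D S).Z ω i k * (D S).L i ω := by
      simp only [Matrix.mulVec, dotProduct, Matrix.transpose_apply, ShiftShare.Y_eq]
      simp only [← Finset.sum_add_distrib]
      exact Finset.sum_congr rfl fun i _ => by ring
    rw [this]
    ring
  have hunit := tendsto_measure_not_isUnit_det (Z := fun S => (D S).Z) hQ hZ
  have hXres : ∀ S ω, IsUnit (((D S).Z ω)ᵀ * (D S).Z ω).det → (D S).Xres ω =
      v S ω - (D S).Z ω *ᵥ ((((D S).Z ω)ᵀ * (D S).Z ω)⁻¹ *ᵥ (((D S).Z ω)ᵀ *ᵥ v S ω)) := by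
    intro S ω h
    rw [ShiftShare.Xres, (D S).X_eq γ ω]
    exact residual_add_mulVec h _ _
  have hden : ConvInProb P (fun S ω => ((D S).Xres ω ⬝ᵥ (D S).Xres ω) / N S) c := by
    have h := hvv.sub (convInProb_projection (Z := fun S => (D S).Z) hN hQ hZ hZv
      fun k => (hZv k).bddInProb)
    rw [sub_zero] at h
    -- The algebraic formula for the residual can fail only where `Z'Z` is singular, an event of
    -- vanishing probability.
    refine h.congr_of_tendsto (tendsto_of_tendsto_of_tendsto_of_le_of_le tendsto_const_nhds hunit
      (fun S => zero_le) fun S => measure_mono fun ω hω hu => hω ?_)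
    rw [hXres S ω hu, residual_dotProduct_self hu, sub_div]
  have hnum : ConvInProb P (fun S ω => ((D S).Xres ω ⬝ᵥ (D S).Y ω) / N S - R S ω / N S) 0 := by
    have h := hvY.sub (convInProb_projection (Z := fun S => (D S).Z) hN hQ hZ hZv hZY)
    rw [sub_zero] at h
    refine h.congr_of_tendsto (tendsto_of_tendsto_of_tendsto_of_le_of_le tendsto_const_nhds hunit
      (fun S => zero_le) fun S => measure_mono fun ω hω hu => hω ?_)
    rw [hXres S ω hu, residual_dotProduct, sub_div]
    ring
  -- Conditional variances are nonnegative, so `R` is at most `|CB|` times the total weight in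
  -- absolute value.
  have hRbdd : BddInProb P (fun S ω => R S ω / N S) := by
    refine (hW.bddInProb.const_mul |CB|).of_abs_le fun S => ?_
    have hσ : ∀ᵐ ω ∂P S, ∀ s, 0 ≤ (D S).condVariance (P S) s ω := ae_all_iff.2 fun s =>
      condExp_nonneg (Eventually.of_forall fun ω => sq_nonneg _)
    filter_upwards [hσ, ae_all_iff.2 fun i => ae_all_iff.2 fun s => hB S i s] with ω h1 h2
    refine le_trans ?_ (le_abs_self _)
    rw [abs_div, Nat.abs_cast, ← mul_div_assoc]
    gcongr
    simp only [R, ShiftShare.totalWeight, Finset.mul_sum]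
    refine (Finset.abs_sum_le_sum_abs _ _).trans (Finset.sum_le_sum fun i _ =>
      (Finset.abs_sum_le_sum_abs _ _).trans (Finset.sum_le_sum fun s _ => ?_))
    have h0 := mul_nonneg (sq_nonneg ((D S).w i s ω)) (h1 s)
    rw [abs_mul, abs_of_nonneg h0, mul_comm]
    exact mul_le_mul_of_nonneg_right (h2 i s) h0
  have hpos : ∀ (S : ℕ) (x : ℝ), 0 < x / N S → 0 < x := fun S x h => by
    by_contra! hx
    exact absurd h (not_lt.2 (div_nonpos_of_nonpos_of_nonneg hx (Nat.cast_nonneg _)))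
  have hWpos := hW.tendsto_measure_not_pos hc
  have hmain : ConvInProb P (fun S ω => (D S).betaHat ω - (D S).betaBar (P S) ω) 0 := by
    refine (ConvInProb.div_sub_div hc.ne' hnum hRbdd hden hW).congr_ae ?_
    filter_upwards [hN] with S hS
    have hS' : (N S : ℝ) ≠ 0 := Nat.cast_ne_zero.2 hS
    refine Eventually.of_forall fun ω => ?_
    simp only [R, ShiftShare.betaHat, ShiftShare.betaBar, div_div_div_cancel_right₀ hS']
  refine ⟨?_, hmain, fun b hb => ?_⟩
  · have h := (hunit.add (hden.tendsto_measure_not_pos hc)).add hWpos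
    simp only [add_zero] at h
    refine tendsto_of_tendsto_of_tendsto_of_le_of_le tendsto_const_nhds h (fun S => zero_le)
      fun S => (measure_mono ?_).trans ((measure_union_le _ _).trans
        (add_le_add (measure_union_le _ _) le_rfl))
    intro ω hω
    by_contra hcon
    simp only [Set.mem_union, Set.mem_ofPred_eq, not_or, not_not] at hcon
    exact hω ⟨hcon.1.1, hpos S _ hcon.1.2, hpos S _ hcon.2⟩
  · have hbar : Tendsto (fun S => P S {ω | (D S).betaBar (P S) ω ≠ b S}) atTop (𝓝 0) := by
      -- With equal effects the common value factors out of the weighted sum, so the estimand can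
      -- differ from it only where the total weight is not positive.
      refine tendsto_of_tendsto_of_tendsto_of_le_of_le tendsto_const_nhds hWpos
        (fun S => zero_le) fun S => measure_mono_ae ?_
      filter_upwards [ae_all_iff.2 fun i => ae_all_iff.2 fun s => hb S i s] with ω h hne hp
      refine hne ?_
      have hp' := hpos S _ hp
      rw [ShiftShare.betaBar, div_eq_iff hp'.ne', ShiftShare.totalWeight]
      simp only [h, ← Finset.sum_mul]
      rw [mul_comm]
    refine ⟨hbar, hmain.congr_of_tendsto (tendsto_of_tendsto_of_tendsto_of_le_of_le
      tendsto_const_nhds hbar (fun S => zero_le) fun S => measure_mono fun ω hω h => hω ?_)⟩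
    rw [h]
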